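/- Let $k$ be a field and let $M$ be a (Hausdorff, second countable, topological) manifold of dimension $n\ge 0$. Let $\mathsf D(k_M)$ be the (unbounded) derived category of sheaves of $k$-vector spaces on $M$, let $k_M$ be the constant sheaf with stalk $k$, viewed as an object of $\mathsf D(k_M)$ in degree $0$, and let $\mathsf D_{\mathrm{lc}}(k_M)\subset \mathsf D(k_M)$ be the full subcategory of those $G$ such that $H^iG$ is a locally constant sheaf for every $i\in\mathbb Z$ (stalks may be infinite-dimensional). For a family $\mathcal F$ of objects of $\mathsf D(k_M)$, let $\mathcal F^{(0)}$ be the family of all objects isomorphic to a finite direct sum $\bigoplus_{i=1}^m F_i[d_i]$ with $F_i\in\mathcal F$ and $d_i\in\mathbb Z$, and define inductively $\mathcal F^{(j+1)}$ as the family of all $F$ for which there is a distinguished triangle $F_1\to F_0\to F\xrightarrow{+1}$ with $F_1\in\mathcal F^{(j)}$ and $F_0\in\mathcal F^{(0)}$. Let $L\in\mathsf D_{\mathrm{lc}}(k_M)$ be such that $H^iL\simeq 0$ for all $i<0$ and $H^0L\simeq k_M$, and set $$\mathcal F=\{F\in \mathsf D(k_M)\;;\; F\simeq L\otimes G\ \text{for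 some } G\in\mathsf D_{\mathrm{lc}}(k_M)\}.$$ Then there exists $F\in\mathcal F^{(\lceil (n-1)/2\rceil)}$ such that $k_M$ is a direct summand of $F$ in $\mathsf D(k_M)$. -/

import Mathlib

open CategoryTheory CategoryTheory.Limits CategoryTheory.Pretriangulated TopologicalSpace

universe w u

noncomputable section

namespace ConeIteration

/-! ### Iterated cones in a triangulated category -/

section Triangulated

variable {T : Type*} [Category* T] [HasZeroObject T] [HasShift T ℤ] [Preadditive T]
  [∀ n : ℤ, (shiftFunctor T n).Additive] [Pretriangulated T]

/-- The family `𝓕⁽⁰⁾` of all objects isomorphic to a finite direct sum `⨁ Eᵢ[dᵢ]` with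
`Eᵢ ∈ 𝓕` and `dᵢ ∈ ℤ`. -/
def FiniteSumsOfShifts (𝓕 : ObjectProperty T) : ObjectProperty T := fun F =>
  ∃ (m : ℕ) (E : Fin m → T) (d : Fin m → ℤ),
    (∀ i, 𝓕 (E i)) ∧ Nonempty (F ≅ ⨁ fun i => (E i)⟦d i⟧)

/-- The families `𝓕⁽ᵏ⁾`: an object `F` is in `𝓕⁽ᵏ⁺¹⁾` if there is a distinguished triangle
`F₁ → F₀ → F → F₁[1]` with `F₁ ∈ 𝓕⁽ᵏ⁾` and `F₀ ∈ 𝓕⁽⁰⁾`. -/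
def IteratedCones (𝓕 : ObjectProperty T) : ℕ → ObjectProperty T
  | 0 => FiniteSumsOfShifts 𝓕
  | k + 1 => fun F =>
      ∃ (F₁ F₀ : T) (f : F₁ ⟶ F₀) (g : F₀ ⟶ F) (h : F ⟶ F₁⟦(1 : ℤ)⟧),
        IteratedCones 𝓕 k F₁ ∧ FiniteSumsOfShifts 𝓕 F₀ ∧
          Triangle.mk f g h ∈ distTriang T

/-- `A` is a direct summand of `F`. -/
def IsDirectSummand (A F : T) : Prop := ∃ B : T, Nonempty (F ≅ A ⊞ B)

end Triangulated

/-! ### Sheaves of vector spaces and their tensor product -/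

section Sheaves

variable (k : Type u) [Field k] (X : TopCat.{u})

/-- The category of sheaves of `k`-vector spaces on the topological space `X`. -/
abbrev Sh : Type (u + 1) :=
  CategoryTheory.Sheaf (Opens.grothendieckTopology X) (ModuleCat.{u} k)

/-- The tensor product over `k` of sheaves: the sheafification of the tensor product of
presheaves. -/
instance instMonoidalSh : MonoidalCategory (Sh k X) :=
  CategoryTheory.Sheaf.monoidalCategory (Opens.grothendieckTopology X) (ModuleCat.{u} k)

/-- The sheafification functor. -/
abbrev sheafification : ((Opens X)ᵒᵖ ⥤ ModuleCat.{u} k) ⥤ Sh k X :=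
  presheafToSheaf (Opens.grothendieckTopology X) (ModuleCat.{u} k)

/-- A sheaf is the sheafification of its underlying presheaf. -/
def sheafificationIso :
    sheafToPresheaf (Opens.grothendieckTopology X) (ModuleCat.{u} k) ⋙ sheafification k X ≅
      𝟭 (Sh k X) :=
  asIso (sheafificationAdjunction (Opens.grothendieckTopology X) (ModuleCat.{u} k)).counit

instance instMonoidalPreadditivePresheaf :
    MonoidalPreadditive ((Opens X)ᵒᵖ ⥤ ModuleCat.{u} k) where
  whiskerLeft_zero := by intros; ext : 2; exact MonoidalPreadditive.whiskerLeft_zero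
  zero_whiskerRight := by intros; ext : 2; exact MonoidalPreadditive.zero_whiskerRight
  whiskerLeft_add := by intros; ext : 2; exact MonoidalPreadditive.whiskerLeft_add _ _
  add_whiskerRight := by intros; ext : 2; exact MonoidalPreadditive.add_whiskerRight _ _

theorem tensorLeft_additive (F : Sh k X) : (MonoidalCategory.tensorLeft F).Additive :=
  Functor.additive_of_iso
    (Functor.isoWhiskerLeft
        (sheafToPresheaf (Opens.grothendieckTopology X) (ModuleCat.{u} k))
        (Functor.Monoidal.commTensorLeft (sheafification k X) F.obj).symm ≪≫
      (Functor.associator _ _ _).symm ≪≫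
      Functor.isoWhiskerRight (sheafificationIso k X) _ ≪≫ Functor.leftUnitor _ ≪≫
      (MonoidalCategory.tensoringLeft (Sh k X)).mapIso ((sheafificationIso k X).app F))

theorem tensorRight_additive (F : Sh k X) : (MonoidalCategory.tensorRight F).Additive :=
  Functor.additive_of_iso
    (Functor.isoWhiskerLeft
        (sheafToPresheaf (Opens.grothendieckTopology X) (ModuleCat.{u} k))
        (Functor.Monoidal.commTensorRight (sheafification k X) F.obj).symm ≪≫
      (Functor.associator _ _ _).symm ≪≫
      Functor.isoWhiskerRight (sheafificationIso k X) _ ≪≫ Functor.leftUnitor _ ≪≫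
      (MonoidalCategory.tensoringRight (Sh k X)).mapIso ((sheafificationIso k X).app F))

instance instMonoidalPreadditiveSh : MonoidalPreadditive (Sh k X) where
  whiskerLeft_zero {F _ _} := by
    have := tensorLeft_additive k X F
    exact (MonoidalCategory.tensorLeft F).map_zero _ _
  zero_whiskerRight {F _ _} := by
    have := tensorRight_additive k X F
    exact (MonoidalCategory.tensorRight F).map_zero _ _
  whiskerLeft_add {F _ _} _ _ := by
    have := tensorLeft_additive k X F
    exact (MonoidalCategory.tensorLeft F).map_add
  add_whiskerRight {F _ _} _ _ := by
    have := tensorRight_additive k X F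
    exact (MonoidalCategory.tensorRight F).map_add

theorem hasColimitsOfSize_zero : HasColimitsOfSize.{0, 0} (Sh k X) :=
  have h : HasColimitsOfSize.{0, 0} (ModuleCat.{u} k) :=
    hasColimitsOfSizeShrink.{0, 0, u, u} (ModuleCat.{u} k)
  ⟨fun _ _ => have := h.has_colimits_of_shape; Sheaf.instHasColimitsOfShape⟩

instance instHasTensor (K₁ K₂ : CochainComplex (Sh k X) ℤ) :
    HomologicalComplex.HasTensor K₁ K₂ := fun _ =>
  ((hasColimitsOfSize_zero k X).has_colimits_of_shape _).has_colimit _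

/-- The constant sheaf `k_X`. -/
def constSheaf : Sh k X :=
  (constantSheaf (Opens.grothendieckTopology X) (ModuleCat.{u} k)).obj (ModuleCat.of k k)

variable {k X}

/-- `F` is locally constant: each point has an open neighbourhood `U` such that `F|_U` is
isomorphic to the constant sheaf on `U` of some `k`-vector space, of any dimension. -/
def IsLocallyConstantSheaf (F : Sh k X) : Prop :=
  ∀ x : X, ∃ U : Opens X, x ∈ U ∧
    CategoryTheory.Sheaf.IsConstant (Opens.grothendieckTopology U) (U.sheafRestrict.obj F)

end Sheaves

/-! ### The derived category `D(k_X)` -/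

section Derived

variable (k : Type u) [Field k] (X : TopCat.{u}) [HasDerivedCategory.{w} (Sh k X)]

/-- The constant sheaf `k_X` as an object of `D(k_X)`, placed in degree `0`. -/
def constObj : DerivedCategory (Sh k X) :=
  (DerivedCategory.singleFunctor (Sh k X) 0).obj (constSheaf k X)

variable {k X}

/-- `D_lc(k_X)`: the objects of `D(k_X)` all of whose cohomology sheaves are locally constant. -/
def Dlc : ObjectProperty (DerivedCategory (Sh k X)) := fun G =>
  ∀ i : ℤ, IsLocallyConstantSheaf ((DerivedCategory.homologyFunctor (Sh k X) i).obj G)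

/-- `F ≃ L ⊗ G` in `D(k_X)`. As `k` is a field, the tensor product of sheaves of `k`-vector
spaces is exact and every complex of such sheaves is K-flat; so the derived tensor product of
`L` and `G` is the total tensor product complex of any complexes representing `L` and `G`. -/
def IsTensor (L G F : DerivedCategory (Sh k X)) : Prop :=
  ∃ K₁ K₂ : CochainComplex (Sh k X) ℤ,
    Nonempty (DerivedCategory.Q.obj K₁ ≅ L) ∧ Nonempty (DerivedCategory.Q.obj K₂ ≅ G) ∧
      Nonempty (F ≅ DerivedCategory.Q.obj (HomologicalComplex.tensorObj K₁ K₂))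

/-- The family of all `F` with `F ≃ L ⊗ G` for some `G ∈ D_lc(k_X)`. -/
def tensorFamily (L : DerivedCategory (Sh k X)) : ObjectProperty (DerivedCategory (Sh k X)) :=
  fun F => ∃ G, Dlc G ∧ IsTensor L G F

end Derived

end ConeIteration

end

/-!
Represent `L` by a complex `K` in nonnegative degrees and let `C` be the cone of the inclusion
`k_M = H⁰(K) → K`, a complex with locally constant cohomology in degrees `≥ 1`. Tensoring with
`C^{⊗ i}` gives distinguished triangles `C^{⊗ i} → K ⊗ C^{⊗ i} → C^{⊗ (i + 1)} → C^{⊗ i}[1]`. Their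
connecting morphisms compose to a morphism `u : C^{⊗ (j + 1)}[-j-1] → k_M`, and by the octahedral
axiom its cone is a `j`-fold iterated cone on the objects `K ⊗ C^{⊗ i}`. By the Künneth formula, the
source of `u` lives in degrees `≥ 2j + 2`. As `k_M` has injective dimension at most `n`, it follows
that `u = 0` once `n ≤ 2j + 1`, and then the cone of `u` contains `k_M` as a direct summand.

The injective dimension is bounded by means of the vanishing of `Hᵖ(U; R)` for `U` open in `ℝⁿ` and
`p ≥ max 1 n`: it makes the sheaf of `n`-cocycles in an injective resolution of `k_M` flasque in the
charts, and locally flasque sheaves of vector spaces are injective.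
-/

noncomputable section

namespace ConeIteration

/-! ### Cohomology of open subsets of `ℝⁿ` -/

section FinitelyGenerated

variable {R V : Type*} [Ring R] [AddCommGroup V] [Module R V]

lemma exists_fg_le_left_of_le_sup {D A B : Submodule R V} (hD : D.FG) (h : D ≤ A ⊔ B) :
    ∃ T ≤ A, T.FG ∧ D ≤ T ⊔ B := by
  obtain ⟨F, rfl⟩ := hD
  have hF : ∀ x : F, ∃ a ∈ A, ∃ b ∈ B, a + b = x := fun x =>
    Submodule.mem_sup.1 (h (Submodule.subset_span x.2))
  choose a ha b hb hab using hF
  refine ⟨Submodule.span R (Set.range a), Submodule.span_le.2 (Set.range_subset_iff.2 ha),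
    Submodule.fg_span (Set.finite_range a), Submodule.span_le.2 fun x hx => ?_⟩
  exact Submodule.mem_sup.2 ⟨_, Submodule.subset_span ⟨⟨x, hx⟩, rfl⟩, _, hb ⟨x, hx⟩, hab _⟩

variable [IsNoetherianRing R]

lemma exists_fg_le_of_le_fg_sup {Z T B : Submodule R V} (hT : T.FG) (h : Z ≤ T ⊔ B) :
    ∃ T' ≤ Z, T'.FG ∧ Z ≤ T' ⊔ B := by
  obtain ⟨T', hT'Z, hT', hle⟩ := exists_fg_le_left_of_le_sup
    (hT.of_le (inf_le_left : T ⊓ (Z ⊔ B) ≤ T)) inf_le_right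
  refine ⟨T', hT'Z, hT', ?_⟩
  calc Z ≤ (B ⊔ T) ⊓ (Z ⊔ B) := le_inf (h.trans_eq (sup_comm _ _)) le_sup_left
    _ = B ⊔ T ⊓ (Z ⊔ B) := sup_inf_assoc_of_le _ le_sup_right
    _ ≤ T' ⊔ B := sup_le le_sup_right hle

lemma exists_fg_le_sup_inf {Z T₁ T₂ B₁ B₂ : Submodule R V} (hT₁ : T₁.FG) (hT₂ : T₂.FG)
    (h₁ : Z ≤ T₁ ⊔ B₁) (h₂ : Z ≤ T₂ ⊔ B₂) :
    ∃ T : Submodule R V, T.FG ∧ Z ≤ T ⊔ (B₁ ⊓ B₂) := by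
  obtain ⟨S₁, hS₁Z, hS₁, hle₁⟩ := exists_fg_le_of_le_fg_sup hT₁ h₁
  obtain ⟨S₂, hS₂Z, hS₂, hle₂⟩ :=
    exists_fg_le_of_le_fg_sup hT₂ ((inf_le_right : B₁ ⊓ Z ≤ Z).trans h₂)
  refine ⟨S₁ ⊔ S₂, hS₁.sup hS₂, ?_⟩
  calc Z ≤ (S₁ ⊔ B₁) ⊓ Z := le_inf hle₁ le_rfl
    _ = S₁ ⊔ B₁ ⊓ Z := sup_inf_assoc_of_le _ hS₁Z
    _ ≤ S₁ ⊔ (S₂ ⊔ B₂) ⊓ (B₁ ⊓ Z) := sup_le_sup_left (le_inf hle₂ le_rfl) _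
    _ = S₁ ⊔ (S₂ ⊔ B₂ ⊓ (B₁ ⊓ Z)) := by rw [sup_inf_assoc_of_le _ hS₂Z]
    _ ≤ (S₁ ⊔ S₂) ⊔ (B₁ ⊓ B₂) := by
      rw [← sup_assoc]
      exact sup_le_sup_left (le_inf (inf_le_right.trans inf_le_left) inf_le_left) _

end FinitelyGenerated

section IntervalInduction

lemma forall_Icc_of_local_of_union {P : Set ℝ → Prop}
    (hloc : ∀ t, ∃ U, IsOpen U ∧ t ∈ U ∧ ∀ C ⊆ U, P C)
    (hunion : ∀ a b c, a ≤ b → b ≤ c → P (Set.Icc a b) → P (Set.Icc b c) → P (Set.Icc a c))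
    {a b : ℝ} (hab : a ≤ b) : P (Set.Icc a b) := by
  choose U hU htU hP using hloc
  obtain ⟨τ, hτ₀, hτ, ⟨m, hm⟩, hτU⟩ := exists_monotone_Icc_subset_open_cover_Icc hab
    (c := fun t => Subtype.val ⁻¹' U t) (fun t => (hU t).preimage continuous_subtype_val)
    (fun t _ => Set.mem_iUnion.2 ⟨t, htU t⟩)
  have hinitial : ∀ j, P (Set.Icc a (τ j)) := by
    intro j
    induction j with
    | zero =>
      rw [hτ₀, Set.Icc_self]
      exact hP a _ (Set.singleton_subset_iff.2 (htU a))
    | succ j ih =>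
      obtain ⟨i, hi⟩ := hτU j
      refine hunion _ _ _ (τ j).2.1 (hτ j.le_succ) ih (hP i _ fun x hx => ?_)
      exact hi (a := ⟨x, (τ j).2.1.trans hx.1, hx.2.trans (τ (j + 1)).2.2⟩) hx
  simpa [hm m le_rfl] using hinitial m

end IntervalInduction

/-- An abstraction of the complex of global sections of a complex of flabby sheaves of `R`-modules:
a complex whose terms carry, for each open subset `U`, a submodule of elements vanishing on `U`. -/
structure SupportedComplex (R : Type*) [Ring R] (X : Type*) [TopologicalSpace X] where
  Sec : ℤ → Type u
  [addCommGroup : ∀ p, AddCommGroup (Sec p)]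
  [module : ∀ p, Module R (Sec p)]
  d : ∀ p q, Sec p →ₗ[R] Sec q
  d_d : ∀ p q r x, d q r (d p q x) = 0
  vanishing : ∀ p, Opens X → Submodule R (Sec p)
  d_mem : ∀ {p U x} (q), x ∈ vanishing p U → d p q x ∈ vanishing q U
  anti : ∀ {p U V}, U ≤ V → vanishing p V ≤ vanishing p U
  mem_sSup : ∀ {p} (𝒰 : Set (Opens X)) {x}, (∀ U ∈ 𝒰, x ∈ vanishing p U) → x ∈ vanishing p (sSup 𝒰)
  inf_le : ∀ {p U V}, vanishing p (U ⊓ V) ≤ vanishing p U ⊔ vanishing p V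
  glue : ∀ {p} (U : ℕ → Opens X), Monotone U → ∀ s : ℕ → Sec p,
    (∀ j, s (j + 1) - s j ∈ vanishing p (U j)) → ∃ t, ∀ j, t - s j ∈ vanishing p (U j)

namespace SupportedComplex

attribute [instance] SupportedComplex.addCommGroup SupportedComplex.module

variable {R : Type*} [Ring R] {X : Type*} [TopologicalSpace X]

section Germs

variable (S : SupportedComplex.{u} R X)

lemma mem_vanishing_sup {p : ℤ} {U V : Opens X} {x : S.Sec p} (hU : x ∈ S.vanishing p U)
    (hV : x ∈ S.vanishing p V) : x ∈ S.vanishing p (U ⊔ V) := by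
  rw [← sSup_pair]
  exact S.mem_sSup _ (by rintro _ (rfl | rfl) <;> assumption)

lemma mem_vanishing_bot {p : ℤ} (x : S.Sec p) : x ∈ S.vanishing p ⊥ := by
  rw [← sSup_empty]
  exact S.mem_sSup _ (by simp)

/-- The elements vanishing in a neighbourhood of the set `K`. -/
def vanishingNear (p : ℤ) (K : Set X) : Submodule R (S.Sec p) where
  carrier := {s | ∃ U : Opens X, K ⊆ U ∧ s ∈ S.vanishing p U}
  add_mem' := by
    rintro a b ⟨U, hU, ha⟩ ⟨V, hV, hb⟩
    exact ⟨U ⊓ V, Set.subset_inter hU hV,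
      add_mem (S.anti inf_le_left ha) (S.anti inf_le_right hb)⟩
  zero_mem' := ⟨⊤, by simp, zero_mem _⟩
  smul_mem' := by
    rintro c a ⟨U, hU, ha⟩
    exact ⟨U, hU, Submodule.smul_mem _ _ ha⟩

/-- The elements which are cocycles in a neighbourhood of the set `K`. -/
def cocyclesNear (p q : ℤ) (K : Set X) : Submodule R (S.Sec p) :=
  (S.vanishingNear q K).comap (S.d p q)

/-- The elements which are coboundaries in a neighbourhood of the set `K`. -/
def coboundariesNear (o p : ℤ) (K : Set X) : Submodule R (S.Sec p) :=
  S.vanishingNear p K ⊔ LinearMap.range (S.d o p)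

/-- The germs of the complex along `K` have no cohomology in degree `p`, where `o`, `p`, `q` are
meant to be consecutive. -/
def AcyclicNear (o p q : ℤ) (K : Set X) : Prop := S.cocyclesNear p q K ≤ S.coboundariesNear o p K

/-- Every cocycle near `K` of degree `p` coincides near `K` with a global cocycle, where `p`, `q`
are meant to be consecutive. -/
def CocyclesExtend (p q : ℤ) (K : Set X) : Prop :=
  S.cocyclesNear p q K ≤ LinearMap.ker (S.d p q) ⊔ S.vanishingNear p K

/-- The cohomology in degree `p` of the germs of the complex along `K` is finitely generated, where
`o`, `p`, `q` are meant to be consecutive. -/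
def FiniteCohomologyNear (o p q : ℤ) (K : Set X) : Prop :=
  ∃ T : Submodule R (S.Sec p), T.FG ∧ S.cocyclesNear p q K ≤ T ⊔ S.coboundariesNear o p K

end Germs

variable {S : SupportedComplex.{u} R X} {o p q : ℤ} {K K' K₁ K₂ K₃ : Set X} {s : S.Sec p}

lemma mem_cocyclesNear : s ∈ S.cocyclesNear p q K ↔ S.d p q s ∈ S.vanishingNear q K := Iff.rfl

lemma mem_coboundariesNear :
    s ∈ S.coboundariesNear o p K ↔ ∃ y, s - S.d o p y ∈ S.vanishingNear p K := by
  unfold coboundariesNear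
  rw [Submodule.mem_sup]
  constructor
  · rintro ⟨a, ha, _, ⟨y, rfl⟩, rfl⟩
    exact ⟨y, by simpa using ha⟩
  · rintro ⟨y, hy⟩
    exact ⟨_, hy, _, ⟨y, rfl⟩, by simp⟩

lemma vanishingNear_anti (h : K ⊆ K') : S.vanishingNear p K' ≤ S.vanishingNear p K :=
  fun _ ⟨U, hU, hs⟩ => ⟨U, h.trans hU, hs⟩

lemma cocyclesNear_anti (h : K ⊆ K') : S.cocyclesNear p q K' ≤ S.cocyclesNear p q K :=
  Submodule.comap_mono (vanishingNear_anti h)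

lemma coboundariesNear_anti (h : K ⊆ K') : S.coboundariesNear o p K' ≤ S.coboundariesNear o p K :=
  sup_le_sup_right (vanishingNear_anti h) _

lemma d_mem_vanishingNear (q : ℤ) (h : s ∈ S.vanishingNear p K) :
    S.d p q s ∈ S.vanishingNear q K :=
  let ⟨U, hU, hs⟩ := h
  ⟨U, hU, S.d_mem q hs⟩

lemma mem_vanishingNear_empty (s : S.Sec p) : s ∈ S.vanishingNear p ∅ :=
  ⟨⊥, by simp, S.mem_vanishing_bot s⟩

lemma mem_vanishingNear_union (h₁ : s ∈ S.vanishingNear p K₁) (h₂ : s ∈ S.vanishingNear p K₂) :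
    s ∈ S.vanishingNear p (K₁ ∪ K₂) := by
  obtain ⟨U, hU, hs⟩ := h₁
  obtain ⟨V, hV, hs'⟩ := h₂
  exact ⟨U ⊔ V, Set.union_subset_union hU hV, S.mem_vanishing_sup hs hs'⟩

lemma mem_vanishingNear_of_forall_singleton (h : ∀ x ∈ K, s ∈ S.vanishingNear p {x}) :
    s ∈ S.vanishingNear p K := by
  refine ⟨sSup {U | s ∈ S.vanishing p U}, fun x hx => ?_, S.mem_sSup _ (fun U hU => hU)⟩
  obtain ⟨U, hU, hs⟩ := h x hx
  exact Opens.mem_sSup.2 ⟨U, hs, hU rfl⟩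

lemma isOpen_setOf_mem_vanishingNear_singleton (s : S.Sec p) :
    IsOpen {x | s ∈ S.vanishingNear p {x}} := by
  rw [isOpen_iff_forall_mem_open]
  rintro x ⟨U, hU, hsU⟩
  exact ⟨U, fun y hy => ⟨U, Set.singleton_subset_iff.2 hy, hsU⟩, U.isOpen, hU rfl⟩

lemma vanishingNear_inter_le [T2Space X] (h₁ : IsCompact K₁) (h₂ : IsCompact K₂) :
    S.vanishingNear p (K₁ ∩ K₂) ≤ S.vanishingNear p K₁ ⊔ S.vanishingNear p K₂ := by
  rintro s ⟨W, hW, hs⟩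
  obtain ⟨G₁, G₂, hG₁, hG₂, hK₁, hK₂, hd⟩ := SeparatedNhds.of_isCompact_isCompact
    (h₁.diff W.isOpen) (h₂.diff W.isOpen)
    (Set.disjoint_left.2 fun x hx₁ hx₂ => hx₁.2 (hW ⟨hx₁.1, hx₂.1⟩))
  let V₁ : Opens X := ⟨G₁, hG₁⟩ ⊔ W
  let V₂ : Opens X := ⟨G₂, hG₂⟩ ⊔ W
  have hV : V₁ ⊓ V₂ ≤ W := by
    rintro x ⟨hx₁ | hx₁, hx₂ | hx₂⟩
    · exact (Set.disjoint_left.1 hd hx₁ hx₂).elim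
    all_goals assumption
  have hcover : ∀ {K G : Set X}, K \ W ⊆ G → K ⊆ G ∪ W := fun h =>
    Set.sdiff_subset_iff.1 h |>.trans_eq (Set.union_comm _ _)
  obtain ⟨a, ha, b, hb, rfl⟩ := Submodule.mem_sup.1 (S.inf_le (S.anti hV hs))
  exact Submodule.add_mem_sup ⟨V₁, hcover hK₁, ha⟩ ⟨V₂, hcover hK₂, hb⟩

lemma sub_mem_cocyclesNear {y₁ y₂ : S.Sec o} (h₁ : s - S.d o p y₁ ∈ S.vanishingNear p K)
    (h₂ : s - S.d o p y₂ ∈ S.vanishingNear p K) : y₁ - y₂ ∈ S.cocyclesNear o p K := by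
  rw [mem_cocyclesNear, map_sub, ← sub_sub_sub_cancel_left]
  exact sub_mem h₂ h₁

lemma acyclicNear_empty (o p q : ℤ) : S.AcyclicNear o p q ∅ := fun _ _ =>
  mem_coboundariesNear.2 ⟨0, mem_vanishingNear_empty _⟩

lemma AcyclicNear.cocyclesExtend (h : S.AcyclicNear o p q K) : S.CocyclesExtend p q K := by
  intro s hs
  obtain ⟨y, hy⟩ := mem_coboundariesNear.1 (h hs)
  exact Submodule.mem_sup.2 ⟨S.d o p y, by simp [S.d_d], _, hy, by simp⟩

lemma AcyclicNear.finiteCohomologyNear (h : S.AcyclicNear o p q K) :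
    S.FiniteCohomologyNear o p q K :=
  ⟨⊥, Submodule.fg_bot, by rw [bot_sup_eq]; exact h⟩

section MayerVietoris

variable [T2Space X] (h₁ : IsCompact K₁) (h₂ : IsCompact K₂)

include h₁ h₂

/-- `T` represents the cohomology of `K₁ ∩ K₂` in degree `o`, and `T'` its image under the
connecting homomorphism to the cohomology of `K₁ ∪ K₂` in degree `p`. -/
lemma coboundariesNear_inf_le {l : ℤ} {T : Submodule R (S.Sec o)} {T' : Submodule R (S.Sec p)}
    (hT : S.cocyclesNear o p (K₁ ∩ K₂) ≤ T ⊔ S.coboundariesNear l o (K₁ ∩ K₂))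
    (hT' : T' ≤ S.vanishingNear p K₁) (hTT' : T.map (S.d o p) ≤ T' ⊔ S.vanishingNear p K₂) :
    S.coboundariesNear o p K₁ ⊓ S.coboundariesNear o p K₂ ≤
      T' ⊔ S.coboundariesNear o p (K₁ ∪ K₂) := by
  rintro s ⟨hs₁, hs₂⟩
  obtain ⟨y₁, hy₁⟩ := mem_coboundariesNear.1 hs₁
  obtain ⟨y₂, hy₂⟩ := mem_coboundariesNear.1 hs₂
  have hz : y₁ - y₂ ∈ S.cocyclesNear o p (K₁ ∩ K₂) := sub_mem_cocyclesNear
    (vanishingNear_anti Set.inter_subset_left hy₁) (vanishingNear_anti Set.inter_subset_right hy₂)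
  obtain ⟨w, hw, b, hb, hwb⟩ := Submodule.mem_sup.1 (hT hz)
  obtain ⟨x, hx⟩ := mem_coboundariesNear.1 hb
  obtain ⟨a₁, ha₁, a₂, ha₂, ha⟩ := Submodule.mem_sup.1 (vanishingNear_inter_le h₁ h₂ hx)
  obtain ⟨τ, hτ, v, hv, hτv⟩ := Submodule.mem_sup.1 (hTT' (Submodule.mem_map_of_mem hw))
  have hd : S.d o p y₁ - S.d o p y₂ = τ + v + S.d o p a₁ + S.d o p a₂ := by
    have hb' : b = a₁ + a₂ + S.d l o x := by rw [ha]; abel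
    rw [← map_sub, ← hwb, hb', map_add, map_add, map_add, S.d_d, ← hτv]
    abel
  refine Submodule.mem_sup.2 ⟨-τ, neg_mem hτ, s + τ,
    mem_coboundariesNear.2 ⟨y₁ - a₁, mem_vanishingNear_union ?_ ?_⟩, by simp⟩
  · rw [show s + τ - S.d o p (y₁ - a₁) = (s - S.d o p y₁) + τ + S.d o p a₁ by
      rw [map_sub]; abel]
    exact add_mem (add_mem hy₁ (hT' hτ)) (d_mem_vanishingNear _ ha₁)
  · rw [show s + τ - S.d o p (y₁ - a₁) = (s - S.d o p y₂) - v - S.d o p a₂ by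
      rw [map_sub, sub_eq_iff_eq_add.1 hd]; abel]
    exact sub_mem (sub_mem hy₂ hv) (d_mem_vanishingNear _ ha₂)

lemma coboundariesNear_inf_le_union (h : S.CocyclesExtend o p (K₁ ∩ K₂)) :
    S.coboundariesNear o p K₁ ⊓ S.coboundariesNear o p K₂ ≤ S.coboundariesNear o p (K₁ ∪ K₂) := by
  have hker : (LinearMap.ker (S.d o p)).map (S.d o p) ≤ ⊥ := by
    rintro _ ⟨w, hw, rfl⟩
    exact hw
  simpa using coboundariesNear_inf_le (l := o) (T' := ⊥) h₁ h₂ (h.trans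
    (sup_le_sup_left le_sup_left _)) bot_le (hker.trans bot_le)

lemma FiniteCohomologyNear.union [IsNoetherianRing R] {l : ℤ}
    (hf₁ : S.FiniteCohomologyNear o p q K₁) (hf₂ : S.FiniteCohomologyNear o p q K₂)
    (hf : S.FiniteCohomologyNear l o p (K₁ ∩ K₂)) : S.FiniteCohomologyNear o p q (K₁ ∪ K₂) := by
  obtain ⟨T₁, hT₁, hZ₁⟩ := hf₁
  obtain ⟨T₂, hT₂, hZ₂⟩ := hf₂
  obtain ⟨T₁₂, hT₁₂, hZ₁₂⟩ := hf
  obtain ⟨T, hT, hZ⟩ := exists_fg_le_sup_inf hT₁ hT₂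
    ((cocyclesNear_anti (S := S) Set.subset_union_left).trans hZ₁)
    ((cocyclesNear_anti Set.subset_union_right).trans hZ₂)
  obtain ⟨W, hWZ, hW, hZW⟩ := exists_fg_le_of_le_fg_sup hT₁₂ hZ₁₂
  have hdW : W.map (S.d o p) ≤ S.vanishingNear p K₁ ⊔ S.vanishingNear p K₂ :=
    Submodule.map_le_iff_le_comap.2
      (hWZ.trans (Submodule.comap_mono (vanishingNear_inter_le h₁ h₂)))
  obtain ⟨T', hT'N, hT', hle⟩ := exists_fg_le_left_of_le_sup (hW.map _) hdW
  refine ⟨T ⊔ T', hT.sup hT', hZ.trans ?_⟩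
  rw [sup_assoc]
  exact sup_le_sup_left (coboundariesNear_inf_le h₁ h₂ hZW hT'N hle) _

end MayerVietoris

section Slices

variable {f : X → ℝ}

lemma exists_isOpen_forall_mem_vanishingNear_preimage (hK : IsCompact K) (hf : Continuous f)
    (t : ℝ) (hs : s ∈ S.vanishingNear p (K ∩ f ⁻¹' {t})) :
    ∃ U : Set ℝ, IsOpen U ∧ t ∈ U ∧ ∀ C ⊆ U, s ∈ S.vanishingNear p (K ∩ f ⁻¹' C) := by
  obtain ⟨V, hV, hs⟩ := hs
  have hclosed : IsClosed (f '' (K \ V)) := ((hK.diff V.isOpen).image hf).isClosed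
  refine ⟨(f '' (K \ V))ᶜ, hclosed.isOpen_compl, ?_, fun C hC => ⟨V, ?_, hs⟩⟩
  · rintro ⟨x, ⟨hx, hxV⟩, rfl⟩
    exact hxV (hV ⟨hx, rfl⟩)
  · rintro x ⟨hx, hxC⟩
    by_contra hxV
    exact hC hxC ⟨x, ⟨hx, hxV⟩, rfl⟩

lemma acyclicNear_of_slices [T2Space X] (hK : IsCompact K) (hf : Continuous f)
    (hacyclic : ∀ t, S.AcyclicNear o p q (K ∩ f ⁻¹' {t}))
    (hextend : ∀ t, S.CocyclesExtend o p (K ∩ f ⁻¹' {t})) : S.AcyclicNear o p q K := by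
  intro s hs
  have hslab : ∀ {a b : ℝ}, a ≤ b → s ∈ S.coboundariesNear o p (K ∩ f ⁻¹' Set.Icc a b) := by
    refine forall_Icc_of_local_of_union (P := fun C => s ∈ S.coboundariesNear o p (K ∩ f ⁻¹' C))
      (fun t => ?_) (fun a b c hab hbc ha hc => ?_)
    · obtain ⟨y, hy⟩ :=
        mem_coboundariesNear.1 (hacyclic t (cocyclesNear_anti Set.inter_subset_left hs))
      obtain ⟨U, hU, htU, hC⟩ := exists_isOpen_forall_mem_vanishingNear_preimage hK hf t hy
      exact ⟨U, hU, htU, fun C h => mem_coboundariesNear.2 ⟨y, hC C h⟩⟩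
    · rw [← Set.Icc_union_Icc_eq_Icc hab hbc, Set.preimage_union, Set.inter_union_distrib_left]
      refine coboundariesNear_inf_le_union (hK.inter_right (isClosed_Icc.preimage hf))
        (hK.inter_right (isClosed_Icc.preimage hf)) ?_ ⟨ha, hc⟩
      rw [← Set.inter_inter_distrib_left, ← Set.preimage_inter,
        Set.Icc_inter_Icc_eq_singleton hab hbc]
      exact hextend b
  obtain ⟨r, hr⟩ := (hK.image hf).isBounded.subset_closedBall 0
  rw [Real.closedBall_eq_Icc, zero_sub, zero_add] at hr
  have hKr : K ⊆ K ∩ f ⁻¹' Set.Icc (-|r|) |r| := fun x hx => ⟨hx,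
    Set.Icc_subset_Icc (neg_le_neg (le_abs_self r)) (le_abs_self r)
      (hr (Set.mem_image_of_mem f hx))⟩
  exact coboundariesNear_anti hKr (hslab (neg_le_self (abs_nonneg r)))

end Slices

section MittagLeffler

variable {K : ℕ → Set X}

lemma eventually_cocyclesNear_le_sup [IsArtinianRing R] (hK : Monotone K) (j : ℕ)
    (hfin : S.FiniteCohomologyNear o p q (K j)) :
    ∀ᶠ m in Filter.atTop, ∀ m' ≥ m,
      S.cocyclesNear p q (K m) ≤ S.cocyclesNear p q (K m') ⊔ S.coboundariesNear o p (K j) := by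
  obtain ⟨T, hT, hZ⟩ := hfin
  let B := S.coboundariesNear o p (K j)
  -- the images of the cohomology groups of the `K m` in the cohomology of `K j`
  let I : ℕ →o (Submodule R (T.map B.mkQ))ᵒᵈ :=
    ⟨fun m => OrderDual.toDual (((S.cocyclesNear p q (K m)).map B.mkQ).comap (T.map B.mkQ).subtype),
      fun m m' h => Submodule.comap_mono (Submodule.map_mono (cocyclesNear_anti (hK h)))⟩
  have : IsArtinian R (T.map B.mkQ) := isArtinian_of_fg_of_artinian _ (hT.map _)
  obtain ⟨n, hn⟩ := IsArtinian.monotone_stabilizes I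
  filter_upwards [Filter.eventually_ge_atTop (max j n)] with m hm m' hm' z hz
  have hzT : B.mkQ z ∈ T.map B.mkQ := by
    have hle := Submodule.map_mono (f := B.mkQ)
      ((cocyclesNear_anti (hK (le_of_max_le_left hm))).trans hZ)
    rw [Submodule.map_sup, Submodule.mkQ_map_self, sup_bot_eq] at hle
    exact hle (Submodule.mem_map_of_mem hz)
  have hI : I m = I m' :=
    (hn m (le_of_max_le_right hm)).symm.trans (hn m' ((le_of_max_le_right hm).trans hm'))
  have hzm : (⟨B.mkQ z, hzT⟩ : T.map B.mkQ) ∈ OrderDual.ofDual (I m) :=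
    Submodule.mem_map_of_mem hz
  rw [hI] at hzm
  rw [sup_comm, ← Submodule.comap_map_mkQ]
  exact hzm

lemma exists_primitive_near_of_le_sup {K₁ K₂ K₃ : Set X} (h₂₃ : K₂ ⊆ K₃)
    (hle : S.cocyclesNear o p K₂ ≤ S.cocyclesNear o p K₃ ⊔ S.coboundariesNear q o K₁)
    (hs : s ∈ S.coboundariesNear o p K₃) {y : S.Sec o}
    (hy : s - S.d o p y ∈ S.vanishingNear p K₂) :
    ∃ y', s - S.d o p y' ∈ S.vanishingNear p K₃ ∧ y' - y ∈ S.vanishingNear o K₁ := by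
  obtain ⟨y₃, hy₃⟩ := mem_coboundariesNear.1 hs
  obtain ⟨w, hw, b, hb, hwb⟩ := Submodule.mem_sup.1
    (hle (sub_mem_cocyclesNear (vanishingNear_anti h₂₃ hy₃) hy))
  obtain ⟨x, hx⟩ := mem_coboundariesNear.1 hb
  refine ⟨y₃ - w - S.d q o x, ?_, ?_⟩
  · rw [show s - S.d o p (y₃ - w - S.d q o x) = (s - S.d o p y₃) + S.d o p w by
      rw [map_sub, map_sub, S.d_d]; abel]
    exact add_mem hy₃ hw
  · rwa [show y₃ - w - S.d q o x - y = b - S.d q o x by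
      rw [← sub_eq_iff_eq_add'.2 hwb.symm]; abel]

lemma exists_primitive_of_mittagLeffler (hK : Monotone K)
    (hle : ∀ j, S.cocyclesNear o p (K (j + 1)) ≤
      S.cocyclesNear o p (K (j + 2)) ⊔ S.coboundariesNear q o (K j))
    (hs : ∀ j, s ∈ S.coboundariesNear o p (K j)) :
    ∃ y, ∀ j, s - S.d o p y ∈ S.vanishing p ⟨interior (K j), isOpen_interior⟩ := by
  have hstep (j : ℕ) (y : {y // s - S.d o p y ∈ S.vanishingNear p (K (j + 1))}) :
      ∃ y' : {y // s - S.d o p y ∈ S.vanishingNear p (K (j + 2))},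
        y'.1 - y.1 ∈ S.vanishingNear o (K j) :=
    let ⟨y', hy', hsub⟩ :=
      exists_primitive_near_of_le_sup (hK (Nat.le_succ _)) (hle j) (hs (j + 2)) y.2
    ⟨⟨y', hy'⟩, hsub⟩
  choose next hnext using hstep
  obtain ⟨y₀, hy₀⟩ := mem_coboundariesNear.1 (hs 1)
  let seq : ∀ j : ℕ, {y // s - S.d o p y ∈ S.vanishingNear p (K (j + 1))} :=
    Nat.rec ⟨y₀, hy₀⟩ next
  have hinterior : ∀ {i : ℤ} (j : ℕ), S.vanishingNear i (K j) ≤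
      S.vanishing i ⟨interior (K j), isOpen_interior⟩ := by
    rintro i j x ⟨U, hU, hx⟩
    exact S.anti (interior_subset.trans hU) hx
  obtain ⟨t, ht⟩ := S.glue (fun j => ⟨interior (K j), isOpen_interior⟩)
    (fun i j hij => interior_mono (hK hij)) (fun j => (seq j).1)
    (fun j => hinterior j (hnext j (seq j)))
  refine ⟨t, fun j => ?_⟩
  rw [show s - S.d o p t = (s - S.d o p (seq j).1) - S.d o p (t - (seq j).1) by
    rw [map_sub]; abel]
  exact sub_mem (hinterior j (vanishingNear_anti (hK (Nat.le_succ j)) (seq j).2))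
    (S.d_mem p (ht j))

end MittagLeffler

variable (S) in
/-- On the open subset `O`, the complex is a resolution of the constant sheaf with stalk `R`
generated by the global section `e`. -/
structure IsConstResolution (O : Set X) (e : S.Sec 0) : Prop where
  eq_zero : ∀ p < 0, ∀ s : S.Sec p, s = 0
  d_e : ∀ q, S.d 0 q e = 0
  eq_zero_of_smul_mem : ∀ x ∈ O, ∀ c : R, c • e ∈ S.vanishingNear 0 {x} → c = 0
  exists_sub_smul_mem : ∀ x ∈ O, ∀ s ∈ S.cocyclesNear 0 1 {x},
    ∃ c : R, s - c • e ∈ S.vanishingNear 0 {x}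
  acyclicNear : ∀ {o p q : ℤ}, o + 1 = p → p + 1 = q → p ≠ 0 → ∀ x ∈ O, S.AcyclicNear o p q {x}

namespace IsConstResolution

section

variable {O : Set X} {e : S.Sec 0} (hS : S.IsConstResolution O e)

include hS

lemma exists_sub_smul_mem_of_isPreconnected (hK : IsPreconnected K) (hKO : K ⊆ O) {s : S.Sec 0}
    (hs : s ∈ S.cocyclesNear 0 1 K) : ∃ c : R, s - c • e ∈ S.vanishingNear 0 K := by
  rcases K.eq_empty_or_nonempty with rfl | ⟨x₀, hx₀⟩
  · exact ⟨0, mem_vanishingNear_empty _⟩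
  have hloc : ∀ x ∈ K, ∃ c : R, s - c • e ∈ S.vanishingNear 0 {x} := fun x hx =>
    hS.exists_sub_smul_mem x (hKO hx) s (cocyclesNear_anti (Set.singleton_subset_iff.2 hx) hs)
  obtain ⟨c, hc⟩ := hloc x₀ hx₀
  refine ⟨c, mem_vanishingNear_of_forall_singleton ?_⟩
  by_contra! hcon
  obtain ⟨x₁, hx₁, hx₁c⟩ := hcon
  obtain ⟨c₁, hc₁⟩ := hloc x₁ hx₁
  let V : R → Set X := fun c' => {x | s - c' • e ∈ S.vanishingNear 0 {x}}
  have hV : ∀ c', IsOpen (V c') := fun c' => isOpen_setOf_mem_vanishingNear_singleton _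
  have hcover : K ⊆ V c ∪ ⋃ c' ∈ ({c}ᶜ : Set R), V c' := fun x hx => by
    obtain ⟨c', hc'⟩ := hloc x hx
    by_cases h : c' = c
    · exact Or.inl (h ▸ hc')
    · exact Or.inr (Set.mem_biUnion h hc')
  obtain ⟨x, hxK, hxc, hx⟩ := hK _ _ (hV c) (isOpen_biUnion fun c' _ => hV c') hcover
    ⟨x₀, hx₀, hc⟩ ⟨x₁, hx₁, Set.mem_biUnion (fun h => hx₁c (h ▸ hc₁)) hc₁⟩
  obtain ⟨c', hc', hxc'⟩ := Set.mem_iUnion₂.1 hx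
  refine hc' (sub_eq_zero.1 (hS.eq_zero_of_smul_mem x (hKO hxK) _ ?_))
  rw [sub_smul, ← sub_sub_sub_cancel_left]
  exact sub_mem hxc hxc'

lemma cocyclesExtend_of_isPreconnected (hK : IsPreconnected K) (hKO : K ⊆ O) :
    S.CocyclesExtend 0 1 K := fun s hs => by
  obtain ⟨c, hc⟩ := hS.exists_sub_smul_mem_of_isPreconnected hK hKO hs
  exact Submodule.mem_sup.2 ⟨c • e, by simp [hS.d_e], _, hc, by simp⟩

lemma acyclicNear_of_subsingleton (hop : o + 1 = p) (hpq : p + 1 = q) (hp : p ≠ 0)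
    (hK : K.Subsingleton) (hKO : K ⊆ O) : S.AcyclicNear o p q K := by
  rcases hK.eq_empty_or_singleton with rfl | ⟨x, rfl⟩
  · exact acyclicNear_empty _ _ _
  · exact hS.acyclicNear hop hpq hp x (hKO rfl)

end

section EuclideanSpace

variable {ι : Type*} {S : SupportedComplex.{u} R (ι → ℝ)} {K O : Set (ι → ℝ)} {e : S.Sec 0}
  (hS : S.IsConstResolution O e)

include hS

lemma acyclicNear_of_card_le_or_convex (T : Finset ι) (hop : o + 1 = p) (hpq : p + 1 = q)
    (hp : 1 ≤ p) (hK : IsCompact K) (hTK : T.card ≤ p ∨ Convex ℝ K) (hKO : K ⊆ O)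
    (hKT : ∀ i ∉ T, ∀ x ∈ K, ∀ y ∈ K, x i = y i) : S.AcyclicNear o p q K := by
  classical
  induction T using Finset.induction_on generalizing o p q K with
  | empty =>
    exact hS.acyclicNear_of_subsingleton hop hpq (by lia)
      (fun x hx y hy => funext fun i => hKT i (by simp) x hx y hy) hKO
  | insert i T hi ih =>
    rw [Finset.card_insert_of_notMem hi] at hTK
    let slice (t : ℝ) : Set (ι → ℝ) := K ∩ (fun x => x i) ⁻¹' {t}
    have hcont : Continuous fun x : ι → ℝ => x i := continuous_apply i
    have hslice (t) : IsCompact (slice t) := hK.inter_right (isClosed_singleton.preimage hcont)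
    have hsliceO (t) : slice t ⊆ O := Set.inter_subset_left.trans hKO
    have hconvex (t) (h : Convex ℝ K) : Convex ℝ (slice t) :=
      h.inter ((convex_singleton t).linear_preimage (LinearMap.proj (R := ℝ) (φ := fun _ => ℝ) i))
    have hsliceT (t) (j) (hj : j ∉ T) (x) (hx : x ∈ slice t) (y) (hy : y ∈ slice t) :
        x j = y j := by
      by_cases hji : j = i
      · exact hji ▸ hx.2.trans hy.2.symm
      · exact hKT j (by simp [hji, hj]) x hx.1 y hy.1
    refine acyclicNear_of_slices hK hcont (fun t => ih hop hpq hp (hslice t)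
      (hTK.imp (by lia) (hconvex t)) (hsliceO t) (hsliceT t)) (fun t => ?_)
    by_cases ho : o = 0
    · subst ho
      obtain rfl : p = 1 := by lia
      refine hS.cocyclesExtend_of_isPreconnected ?_ (hsliceO t)
      rcases hTK with hT | hK
      · obtain rfl : T = ∅ := Finset.card_eq_zero.1 (by lia)
        exact Set.Subsingleton.isPreconnected fun x hx y hy =>
          funext fun j => hsliceT t j (by simp) x hx y hy
      · exact (hconvex t hK).isPreconnected
    · exact (ih (o := o - 1) (by lia) hop (by lia) (hslice t) (hTK.imp (by lia) (hconvex t))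
        (hsliceO t) (hsliceT t)).cocyclesExtend

variable [Finite ι]

lemma finiteCohomologyNear_of_convex (hop : o + 1 = p) (hpq : p + 1 = q) (hK : IsCompact K)
    (hK' : Convex ℝ K) (hKO : K ⊆ O) : S.FiniteCohomologyNear o p q K := by
  have := Fintype.ofFinite ι
  rcases lt_trichotomy p 0 with hp | rfl | hp
  · have hacyclic : S.AcyclicNear o p q K := fun s _ => by
      rw [hS.eq_zero p hp s]
      exact zero_mem _
    exact hacyclic.finiteCohomologyNear
  · obtain rfl : q = 1 := by lia
    refine ⟨Submodule.span R {e}, Submodule.fg_span_singleton e, fun s hs => ?_⟩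
    obtain ⟨c, hc⟩ := hS.exists_sub_smul_mem_of_isPreconnected hK'.isPreconnected hKO hs
    exact Submodule.mem_sup.2 ⟨c • e, Submodule.smul_mem _ _ (Submodule.mem_span_singleton_self e),
      _, (le_sup_left : _ ≤ S.coboundariesNear o 0 K) hc, by simp⟩
  · exact (hS.acyclicNear_of_card_le_or_convex Finset.univ hop hpq (by lia) hK (Or.inr hK') hKO
      (by simp)).finiteCohomologyNear

lemma finiteCohomologyNear_biUnion_of_convex [IsNoetherianRing R] {κ : Type*} (F : Finset κ)
    (c : κ → Set (ι → ℝ)) (hc : ∀ i, IsCompact (c i)) (hc' : ∀ i, Convex ℝ (c i))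
    (hcO : ∀ i, c i ⊆ O) (hop : o + 1 = p) (hpq : p + 1 = q) :
    S.FiniteCohomologyNear o p q (⋃ i ∈ F, c i) := by
  classical
  induction F using Finset.induction_on generalizing c o p q with
  | empty => simpa using (acyclicNear_empty o p q).finiteCohomologyNear
  | insert i F _ ih =>
    rw [Finset.set_biUnion_insert]
    refine FiniteCohomologyNear.union (l := o - 1) (hc i) (F.isCompact_biUnion fun j _ => hc j)
      (hS.finiteCohomologyNear_of_convex hop hpq (hc i) (hc' i) (hcO i))
      (ih c hc hc' hcO hop hpq) ?_
    rw [Set.inter_iUnion₂]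
    exact ih (fun j => c i ∩ c j) (fun j => (hc i).inter (hc j)) (fun j => (hc' i).inter (hc' j))
      (fun j => Set.inter_subset_left.trans (hcO i)) (by lia) hop

end EuclideanSpace

end IsConstResolution

end SupportedComplex

lemma exists_seq_isCompact_convex_cover {E : Type*} [NormedAddCommGroup E] [NormedSpace ℝ E]
    [ProperSpace E] {U : Set E} (hU : IsOpen U) :
    ∃ c : ℕ → Set E, (∀ i, IsCompact (c i)) ∧ (∀ i, Convex ℝ (c i)) ∧ (∀ i, c i ⊆ U) ∧
      U ⊆ ⋃ i, interior (c i) := by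
  rcases U.eq_empty_or_nonempty with rfl | hne
  · exact ⟨fun _ => ∅, by simp, fun _ => convex_empty, by simp, by simp⟩
  choose ε hε hεU using fun x : U => Metric.nhds_basis_closedBall.mem_iff.1 (hU.mem_nhds x.2)
  obtain ⟨T, hT, hTU⟩ := TopologicalSpace.isOpen_iUnion_countable
    (fun x : U => Metric.ball x.1 (ε x)) (fun _ => Metric.isOpen_ball)
  have hcover : U ⊆ ⋃ x ∈ T, Metric.ball x.1 (ε x) := fun x hx => by
    rw [hTU]
    exact Set.mem_iUnion.2 ⟨⟨x, hx⟩, Metric.mem_ball_self (hε _)⟩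
  have hTne : T.Nonempty := by
    obtain ⟨x, hx, -⟩ := Set.mem_iUnion₂.1 (hcover hne.some_mem)
    exact ⟨x, hx⟩
  obtain ⟨f, rfl⟩ := hT.exists_eq_range hTne
  rw [Set.biUnion_range] at hcover
  exact ⟨fun i => Metric.closedBall (f i).1 (ε (f i)), fun i => isCompact_closedBall _ _,
    fun i => convex_closedBall _ _, fun i => hεU _,
    hcover.trans (Set.iUnion_mono fun i => Metric.ball_subset_interior_closedBall)⟩

/-- This is the vanishing of `Hᵖ(U; R)` for `U` open in `ℝⁿ` and `p ≥ max 1 n`: compact subsets have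
no cohomology in degree `p`, and finiteness of the cohomology of finite unions of compact convex
sets gives the Mittag-Leffler condition in degree `p - 1`. -/
theorem SupportedComplex.IsConstResolution.exists_sub_d_mem_vanishing {R : Type*} [Ring R]
    [IsArtinianRing R] {ι : Type*} [Finite ι] {S : SupportedComplex.{u} R (ι → ℝ)}
    {O : Set (ι → ℝ)} {e : S.Sec 0} (hS : S.IsConstResolution O e) {o p q : ℤ} (hop : o + 1 = p)
    (hpq : p + 1 = q) (hp : 1 ≤ p) (hι : Nat.card ι ≤ p) {U : Opens (ι → ℝ)}
    (hU : (U : Set (ι → ℝ)) ⊆ O) {s : S.Sec p} (hs : S.d p q s ∈ S.vanishing q U) :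
    ∃ y, s - S.d o p y ∈ S.vanishing p U := by
  have := Fintype.ofFinite ι
  obtain ⟨c, hc, hc', hcU, hUc⟩ := exists_seq_isCompact_convex_cover U.isOpen
  let K : ℕ → Set (ι → ℝ) := fun j => ⋃ i ∈ Finset.range j, c i
  have hK : Monotone K := fun i j hij =>
    Set.biUnion_subset_biUnion_left (Finset.range_subset_range.2 hij)
  have hKU : ∀ j, K j ⊆ U := fun j => Set.iUnion₂_subset fun i _ => hcU i
  have hcob : ∀ j, s ∈ S.coboundariesNear o p (K j) := fun j =>
    hS.acyclicNear_of_card_le_or_convex Finset.univ hop hpq hp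
      ((Finset.range j).isCompact_biUnion fun i _ => hc i) (Or.inl (by simpa using hι))
      ((hKU j).trans hU) (by simp) ⟨U, hKU j, hs⟩
  have hstable (j : ℕ) := eventually_cocyclesNear_le_sup hK j
    (hS.finiteCohomologyNear_biUnion_of_convex _ c hc hc' (fun i => (hcU i).trans hU)
      (sub_add_cancel o 1) hop)
  obtain ⟨ψ, -, hψ⟩ := exists_seq_of_forall_finset_exists (fun _ : ℕ => True) _ fun F _ =>
    ((F.eventually_all.2 fun j _ => (Filter.eventually_gt_atTop j).and (hstable j)).exists).imp
      fun _ h => ⟨trivial, h⟩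
  have hψmono : StrictMono ψ := fun i j hij => (hψ i j hij).1
  obtain ⟨y, hy⟩ := exists_primitive_of_mittagLeffler (hK.comp hψmono.monotone)
    (fun j => (hψ j (j + 1) j.lt_succ_self).2 _ (hψmono.monotone (Nat.le_succ _)))
    (fun j => hcob (ψ j))
  refine ⟨y, S.anti (fun x hx => ?_)
    (S.mem_sSup (Set.range fun j => ⟨interior (K (ψ j)), isOpen_interior⟩)
      (by rintro _ ⟨j, rfl⟩; exact hy j))⟩
  obtain ⟨i, hi⟩ := Set.mem_iUnion.1 (hUc hx)
  refine Opens.mem_sSup.2 ⟨_, ⟨i + 1, rfl⟩, interior_mono ?_ hi⟩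
  exact Set.subset_biUnion_of_mem (u := c) (Finset.mem_range.2 (hψmono.id_le (i + 1)))

/-! ### Locally flasque sheaves are injective -/

section Sections

open Opposite

variable {k : Type u} [Field k] {X : TopCat.{u}}

/-- The restriction map of a presheaf to a smaller open subset. -/
def presheafRes (P : (Opens X)ᵒᵖ ⥤ ModuleCat.{u} k) {U V : Opens X} (h : V ≤ U) :
    P.obj (op U) →ₗ[k] P.obj (op V) :=
  (P.map (homOfLE h).op).hom

lemma presheafRes_presheafRes (P : (Opens X)ᵒᵖ ⥤ ModuleCat.{u} k) {U V W : Opens X} (h : V ≤ U)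
    (h' : W ≤ V) (s : P.obj (op U)) :
    presheafRes P h' (presheafRes P h s) = presheafRes P (h'.trans h) s :=
  congr($(P.map_comp (homOfLE h).op (homOfLE h').op).hom s).symm

lemma app_presheafRes {P Q : (Opens X)ᵒᵖ ⥤ ModuleCat.{u} k} (η : P ⟶ Q) {U V : Opens X}
    (h : V ≤ U) (s : P.obj (op U)) :
    (η.app (op V)).hom (presheafRes P h s) = presheafRes Q h ((η.app (op U)).hom s) :=
  congr($(η.naturality (homOfLE h).op).hom s)

/-- The `k`-module of sections of a sheaf over an open subset. -/
abbrev sec (F : Sh k X) (U : Opens X) : Type u := F.obj.obj (op U)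

/-- The restriction of sections to a smaller open subset. -/
def res (F : Sh k X) {U V : Opens X} (h : V ≤ U) : sec F U →ₗ[k] sec F V :=
  presheafRes F.obj h

/-- The map induced on sections over an open subset by a morphism of sheaves. -/
def secMap {F G : Sh k X} (f : F ⟶ G) (U : Opens X) : sec F U →ₗ[k] sec G U :=
  (f.hom.app (op U)).hom

lemma res_res (F : Sh k X) {U V W : Opens X} (h : V ≤ U) (h' : W ≤ V) (s : sec F U) :
    res F h' (res F h s) = res F (h'.trans h) s :=
  presheafRes_presheafRes F.obj h h' s

lemma res_self (F : Sh k X) {U : Opens X} (s : sec F U) : res F le_rfl s = s :=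
  congr($(F.obj.map_id (op U)).hom s)

lemma secMap_res {F G : Sh k X} (f : F ⟶ G) {U V : Opens X} (h : V ≤ U) (s : sec F U) :
    secMap f V (res F h s) = res G h (secMap f U s) :=
  app_presheafRes f.hom h s

lemma secMap_comp {F G H : Sh k X} (f : F ⟶ G) (g : G ⟶ H) (U : Opens X) (s : sec F U) :
    secMap (f ≫ g) U s = secMap g U (secMap f U s) := rfl

lemma secMap_zero {F G : Sh k X} (U : Opens X) (s : sec F U) : secMap (0 : F ⟶ G) U s = 0 := rfl

lemma sheafHom_ext {F G : Sh k X} {f g : F ⟶ G} (h : ∀ U s, secMap f U s = secMap g U s) :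
    f = g := by
  apply Sheaf.hom_ext
  ext U s
  exact h U.unop s

/-- The morphism of sheaves given by linear maps on sections which commute with restrictions. -/
def homOfSecMap {F G : Sh k X} (φ : ∀ U, sec F U →ₗ[k] sec G U)
    (hφ : ∀ {U V : Opens X} (h : V ≤ U) (s : sec F U), φ V (res F h s) = res G h (φ U s)) :
    F ⟶ G :=
  ⟨{ app := fun U => ModuleCat.ofHom (φ U.unop)
     naturality := fun U V i => by
      ext s
      exact hφ (leOfHom i.unop) s }⟩

lemma sec_ext (F : Sh k X) {U : Opens X} {s t : sec F U}
    (h : ∀ x ∈ U, ∃ V : Opens X, ∃ hV : V ≤ U, x ∈ V ∧ res F hV s = res F hV t) : s = t := by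
  choose! V hV hx hst using h
  exact TopCat.Sheaf.eq_of_locally_eq' (C := ModuleCat.{u} k) (X := X) F (fun x : U => V x.1) U
    (fun x => homOfLE (hV x.1 x.2)) (fun x hxU => Opens.mem_iSup.2 ⟨⟨x, hxU⟩, hx x hxU⟩) s t
    (fun x => hst x.1 x.2)

lemma exists_glue (F : Sh k X) {ι : Type*} (U : ι → Opens X) (s : ∀ i, sec F (U i))
    (hs : ∀ i j, res F (inf_le_left : U i ⊓ U j ≤ _) (s i) = res F inf_le_right (s j)) :
    ∃ t : sec F (iSup U), ∀ i, res F (le_iSup U i) t = s i :=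
  (TopCat.Sheaf.existsUnique_gluing' (C := ModuleCat.{u} k) (X := X) F U (iSup U)
    (fun i => homOfLE (le_iSup U i)) le_rfl s hs).exists

lemma exists_glue_sup (F : Sh k X) {U V : Opens X} (s : sec F U) (t : sec F V)
    (hst : res F (inf_le_left : U ⊓ V ≤ _) s = res F inf_le_right t) :
    ∃ r : sec F (U ⊔ V), res F le_sup_left r = s ∧ res F le_sup_right r = t := by
  let W : Bool → Opens X := fun b => bif b then U else V
  have hts : res F (inf_le_left : V ⊓ U ≤ _) t = res F inf_le_right s := by
    have := congr(res F (inf_comm V U).le $hst)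
    rw [res_res, res_res] at this
    exact this.symm
  obtain ⟨r, hr⟩ := exists_glue F W (Bool.rec t s) (by
    rintro (_ | _) (_ | _)
    exacts [rfl, hts, hst, rfl])
  have hle : U ⊔ V ≤ iSup W := sup_le (le_iSup W true) (le_iSup W false)
  exact ⟨res F hle r, by rw [res_res]; exact hr true, by rw [res_res]; exact hr false⟩

lemma res_surjective (F : Sh k X) [TopCat.Presheaf.IsFlasque F.obj] {U V : Opens X} (h : V ≤ U) :
    Function.Surjective (res F h) :=
  (ModuleCat.epi_iff_surjective _).1 (TopCat.Presheaf.IsFlasque.epi (F := F.obj) (homOfLE h).op)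

/-- Every point has an open neighbourhood on which the sheaf is flasque. -/
def IsLocallyFlasque (F : Sh k X) : Prop :=
  ∀ x : X, ∃ S : Opens X, x ∈ S ∧ ∀ (W : Opens X) (hW : W ≤ S), Function.Surjective (res F hW)

end Sections

section Exactness

open Opposite

variable {k : Type u} [Field k] {X : TopCat.{u}}

lemma secMap_injective {A B : Sh k X} (i : A ⟶ B) [Mono i] (U : Opens X) :
    Function.Injective (secMap i U) := by
  have : Mono (((sheafToPresheaf _ _).map i).app (op U)) := inferInstance
  exact (ModuleCat.mono_iff_injective _).1 this

lemma exists_secMap_eq_of_epi {F G : Sh k X} (f : F ⟶ G) [Epi f] {U : Opens X} (s : sec G U)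
    {x : X} (hx : x ∈ U) :
    ∃ V : Opens X, ∃ h : V ≤ U, x ∈ V ∧ ∃ t, secMap f V t = res G h s := by
  have : Sheaf.IsLocallySurjective f :=
    (Sheaf.isLocallySurjective_iff_epi' (ModuleCat.{u} k) f).2 inferInstance
  obtain ⟨V, i, ⟨t, ht⟩, hxV⟩ :=
    Presheaf.imageSieve_mem (Opens.grothendieckTopology X) f.hom s x hx
  exact ⟨V, leOfHom i, hxV, t, ht⟩

lemma exists_secMap_eq_of_exact_of_mono {S : ShortComplex (Sh k X)} (hS : S.Exact) [Mono S.f]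
    {U : Opens X} (s : sec S.X₂ U) (hs : secMap S.g U s = 0) : ∃ t, secMap S.f U t = s := by
  let Γ := sheafToPresheaf (Opens.grothendieckTopology X) (ModuleCat.{u} k) ⋙
    (evaluation _ _).obj (op U)
  exact (ShortComplex.moduleCat_exact_iff _).1
    (hS.map_of_mono_of_preservesKernel Γ inferInstance inferInstance) s hs

lemma exists_secMap_eq_of_exact {S : ShortComplex (Sh k X)} (hS : S.Exact)
    {U : Opens X} (s : sec S.X₂ U) (hs : secMap S.g U s = 0) {x : X} (hx : x ∈ U) :
    ∃ V : Opens X, ∃ h : V ≤ U, x ∈ V ∧ ∃ t, secMap S.f V t = res S.X₂ h s := by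
  obtain ⟨z, rfl⟩ := exists_secMap_eq_of_exact_of_mono
    (S := ShortComplex.mk S.iCycles S.g S.iCycles_g)
    (ShortComplex.exact_of_f_is_kernel _ S.cyclesIsKernel) s hs
  have : Epi S.toCycles := S.exact_iff_epi_toCycles.1 hS
  obtain ⟨V, h, hxV, t, ht⟩ := exists_secMap_eq_of_epi S.toCycles z hx
  refine ⟨V, h, hxV, t, ?_⟩
  calc secMap S.f V t = secMap S.iCycles V (secMap S.toCycles V t) := by
        rw [← secMap_comp, S.toCycles_i]
    _ = res S.X₂ h (secMap S.iCycles U z) := by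
        rw [ht]
        exact secMap_res _ _ _

lemma exists_secMap_iCycles_eq (I : CochainComplex (Sh k X) ℤ) {p q : ℤ} (hpq : p + 1 = q)
    {U : Opens X} (s : sec (I.X p) U) (hs : secMap (I.d p q) U s = 0) :
    ∃ t, secMap (I.iCycles p) U t = s :=
  exists_secMap_eq_of_exact_of_mono (S := ShortComplex.mk _ _ (I.iCycles_d p q))
    (ShortComplex.exact_of_f_is_kernel _ (I.cyclesIsKernel p q (by simpa using hpq))) s hs

end Exactness

section Injective

open Opposite

variable {k : Type u} [Field k] {X : TopCat.{u}}

/-- The sheaf of `k`-modules freely generated by a presheaf of sets. -/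
abbrev freeSheaf (k : Type u) [Field k] (X : TopCat.{u}) : ((Opens X)ᵒᵖ ⥤ Type u) ⥤ Sh k X :=
  (Functor.whiskeringRight _ _ _).obj (ModuleCat.free k) ⋙ sheafification k X

/-- The adjunction between `freeSheaf` and the underlying presheaf of sets of a sheaf. -/
def freeSheafAdjunction (k : Type u) [Field k] (X : TopCat.{u}) :
    freeSheaf k X ⊣ sheafToPresheaf _ _ ⋙ (Functor.whiskeringRight _ _ _).obj (forget _) :=
  ((ModuleCat.adj k).whiskerRight (Opens X)ᵒᵖ).comp (sheafificationAdjunction _ _)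

instance mono_freeSheaf_map {P Q : (Opens X)ᵒᵖ ⥤ Type u} (i : P ⟶ Q) [Mono i] :
    Mono ((freeSheaf k X).map i) := by
  have : Mono (Functor.whiskerRight i (ModuleCat.free k)) := by
    have (W : (Opens X)ᵒᵖ) : Mono ((Functor.whiskerRight i (ModuleCat.free k)).app W) :=
      (ModuleCat.mono_iff_injective _).2
        (Finsupp.mapDomain_injective ((mono_iff_injective _).1 (inferInstanceAs (Mono (i.app W)))))
    exact NatTrans.mono_of_mono_app _
  exact (sheafification k X).map_mono (Functor.whiskerRight i (ModuleCat.free k))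

instance isFlasque_of_injective (F : Sh k X) [Injective F] :
    TopCat.Presheaf.IsFlasque F.obj where
  epi {U V} i := by
    refine (ModuleCat.epi_iff_surjective _).2 fun s => ?_
    let adj := freeSheafAdjunction k X
    let σ := (adj.homEquiv _ F).symm (yonedaEquiv.symm s)
    let τ := Injective.factorThru σ ((freeSheaf k X).map (yoneda.map i.unop))
    have hτ : (freeSheaf k X).map (yoneda.map i.unop) ≫ τ = σ := Injective.comp_factorThru _ _
    refine ⟨yonedaEquiv (adj.homEquiv _ F τ), ?_⟩
    calc F.obj.map i (yonedaEquiv (adj.homEquiv _ F τ))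
        = yonedaEquiv (yoneda.map i.unop ≫ adj.homEquiv _ F τ) :=
          yonedaEquiv_naturality (F := F.obj ⋙ forget _) (adj.homEquiv _ F τ) i.unop
      _ = s := by
          rw [← adj.homEquiv_naturality_left, hτ, Equiv.apply_symm_apply, Equiv.apply_symm_apply]

/-- A family of submodules `G U` of `B(U) × F(U)` is the graph of a morphism to `F` from a
subpresheaf of `B`. -/
structure IsPartialGraph {B F : Sh k X} (G : ∀ U : Opens X, Submodule k (sec B U × sec F U)) :
    Prop where
  res_mem : ∀ {U V : Opens X} (h : V ≤ U) {b j}, (b, j) ∈ G U → (res B h b, res F h j) ∈ G V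
  eq_zero : ∀ {U : Opens X} {j}, ((0 : sec B U), j) ∈ G U → j = 0

namespace IsPartialGraph

variable {B F : Sh k X} {G : ∀ U : Opens X, Submodule k (sec B U × sec F U)}

lemma eq (hG : IsPartialGraph G) {U : Opens X} {b j j'} (h : (b, j) ∈ G U) (h' : (b, j') ∈ G U) :
    j = j' :=
  sub_eq_zero.1 (hG.eq_zero (by simpa using sub_mem h h'))

lemma sSup_of_isChain {c : Set (∀ U : Opens X, Submodule k (sec B U × sec F U))}
    (hc : ∀ G ∈ c, IsPartialGraph G) (hchain : IsChain (· ≤ ·) c) (hne : c.Nonempty) :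
    IsPartialGraph (sSup c) := by
  have hmem : ∀ {U : Opens X} {p}, p ∈ (sSup c) U ↔ ∃ G ∈ c, p ∈ G U := by
    intro U p
    have : Nonempty c := hne.to_subtype
    rw [sSup_apply, Submodule.mem_iSup_of_directed]
    · simp only [Subtype.exists, exists_prop]
    · exact hchain.directed.mono_comp (· ≤ ·) (Function.monotone_eval U)
  constructor
  · intro U V h b j hbj
    obtain ⟨G, hG, hbj⟩ := hmem.1 hbj
    exact hmem.2 ⟨G, hG, (hc G hG).res_mem h hbj⟩
  · intro U j hj
    obtain ⟨G, hG, hj⟩ := hmem.1 hj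
    exact (hc G hG).eq_zero hj

/-- The family of graphs generated by `G` and the pair of sections `(b, j)`. -/
def adjoin (G : ∀ U : Opens X, Submodule k (sec B U × sec F U)) {U : Opens X} (b : sec B U)
    (j : sec F U) (V : Opens X) : Submodule k (sec B V × sec F V) :=
  G V ⊔ ⨆ h : V ≤ U, Submodule.span k {(res B h b, res F h j)}

lemma le_adjoin {U : Opens X} (b : sec B U) (j : sec F U) : G ≤ adjoin G b j :=
  fun _ => le_sup_left

lemma mem_adjoin_of_le {U V : Opens X} (h : V ≤ U) {b : sec B U} {j : sec F U} {b' j'} :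
    (b', j') ∈ adjoin G b j V ↔
      ∃ c : k, (b' - c • res B h b, j' - c • res F h j) ∈ G V := by
  rw [adjoin, iSup_pos h, Submodule.mem_sup]
  simp only [Submodule.mem_span_singleton, exists_exists_eq_and]
  constructor
  · rintro ⟨g, hg, c, hc⟩
    obtain rfl := eq_sub_of_add_eq hc
    exact ⟨c, hg⟩
  · rintro ⟨c, hc⟩
    exact ⟨_, hc, c, by simp⟩

lemma adjoin_of_not_le {U V : Opens X} (h : ¬V ≤ U) (b : sec B U) (j : sec F U) :
    adjoin G b j V = G V := by
  rw [adjoin, iSup_neg h, sup_bot_eq]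

lemma isPartialGraph_adjoin (hG : IsPartialGraph G) {U : Opens X} {b : sec B U} {j : sec F U}
    (hbj : ∀ (V : Opens X) (h : V ≤ U) j', (res B h b, j') ∈ G V → j' = res F h j) :
    IsPartialGraph (adjoin G b j) where
  res_mem {V W} h b' j' hb := by
    by_cases hV : V ≤ U
    · obtain ⟨c, hc⟩ := (mem_adjoin_of_le hV).1 hb
      refine (mem_adjoin_of_le (h.trans hV)).2 ⟨c, ?_⟩
      simpa only [map_sub, map_smul, res_res] using hG.res_mem h hc
    · rw [adjoin_of_not_le hV] at hb
      exact le_adjoin b j W (hG.res_mem h hb)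
  eq_zero {V j'} hj' := by
    by_cases hV : V ≤ U
    · obtain ⟨c, hc⟩ := (mem_adjoin_of_le hV).1 hj'
      rcases eq_or_ne c 0 with rfl | hc0
      · exact hG.eq_zero (by simpa using hc)
      · have h : (res B hV b, res F hV j - c⁻¹ • j') ∈ G V := by
          simpa [smul_sub, smul_smul, hc0] using (G V).smul_mem (-c⁻¹) hc
        simpa [hc0] using hbj V hV _ h
    · rw [adjoin_of_not_le hV] at hj'
      exact hG.eq_zero hj'

lemma mem_of_maximal (hG : Maximal IsPartialGraph G) {U : Opens X} {b : sec B U} {j : sec F U}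
    (hbj : ∀ (V : Opens X) (h : V ≤ U) j', (res B h b, j') ∈ G V → j' = res F h j) :
    (b, j) ∈ G U := by
  refine hG.2 (isPartialGraph_adjoin hG.1 hbj) (le_adjoin b j) U
    ((mem_adjoin_of_le le_rfl).2 ⟨1, ?_⟩)
  simp [res_self, ← Prod.zero_eq_mk]

lemma exists_mem_of_maximal (hF : IsLocallyFlasque F) (hG : Maximal IsPartialGraph G) {U : Opens X}
    (b : sec B U) : ∃ j, (b, j) ∈ G U := by
  let I := {V : Opens X // ∃ h : V ≤ U, ∃ j, (res B h b, j) ∈ G V}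
  choose _ jI hjI using fun V : I => V.2
  let W : Opens X := ⨆ V : I, V.1
  obtain ⟨jW, hjW⟩ := exists_glue F (fun V : I => V.1) jI fun V V' => by
    have h₁ := hG.1.res_mem (inf_le_left : V.1 ⊓ V'.1 ≤ _) (hjI V)
    have h₂ := hG.1.res_mem (inf_le_right : V.1 ⊓ V'.1 ≤ _) (hjI V')
    rw [res_res] at h₁ h₂
    exact hG.1.eq h₁ h₂
  have hI (V : Opens X) (h : V ≤ U) (j') (hj' : (res B h b, j') ∈ G V) :
      ∃ hVW : V ≤ W, j' = res F hVW jW :=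
    ⟨le_iSup (fun V : I => V.1) ⟨V, h, j', hj'⟩,
      (hG.1.eq hj' (hjI ⟨V, h, j', hj'⟩)).trans (hjW ⟨V, h, j', hj'⟩).symm⟩
  have hUW : U ≤ W := fun x hx => by
    obtain ⟨S, hxS, hS⟩ := hF x
    obtain ⟨t, ht⟩ := hS (W ⊓ S) inf_le_right (res F inf_le_left jW)
    obtain ⟨h, -⟩ := hI (U ⊓ S) inf_le_left (res F inf_le_right t) <|
      mem_of_maximal hG fun V hV j' hj' => by
        rw [res_res] at hj'
        obtain ⟨hVW, rfl⟩ := hI V _ j' hj'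
        rw [res_res, ← res_res F inf_le_right (le_inf hVW (hV.trans inf_le_right)), ht, res_res]
    exact h ⟨hx, hxS⟩
  refine ⟨res F hUW jW, mem_of_maximal hG fun V hV j' hj' => ?_⟩
  obtain ⟨hVW, rfl⟩ := hI V hV j' hj'
  rw [res_res]

lemma exists_hom (hG : IsPartialGraph G) (h : ∀ U b, ∃ j, (b, j) ∈ G U) :
    ∃ f : B ⟶ F, ∀ U b, (b, secMap f U b) ∈ G U := by
  choose φ hφ using h
  let f : B ⟶ F := homOfSecMap
    (fun U => { toFun := φ U
                map_add' := fun b b' => hG.eq (hφ U _) (add_mem (hφ U b) (hφ U b'))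
                map_smul' := fun c b => hG.eq (hφ U _) ((G U).smul_mem c (hφ U b)) })
    (fun {U V} h s => hG.eq (hφ V _) (hG.res_mem h (hφ U s)))
  exact ⟨f, hφ⟩

end IsPartialGraph

theorem IsLocallyFlasque.injective {F : Sh k X} (hF : IsLocallyFlasque F) : Injective F where
  factors {A B} φ i _ := by
    let G₀ : ∀ U : Opens X, Submodule k (sec B U × sec F U) := fun U =>
      LinearMap.range ((secMap i U).prod (secMap φ U))
    have hG₀ : IsPartialGraph G₀ := by
      constructor
      · rintro U V h _ _ ⟨a, ha⟩
        obtain ⟨rfl, rfl⟩ := Prod.mk.inj ha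
        exact ⟨res A h a, Prod.ext (secMap_res i h a) (secMap_res φ h a)⟩
      · rintro U j ⟨a, ha⟩
        obtain ⟨ha₀, rfl⟩ := Prod.mk.inj ha
        rw [secMap_injective i U (ha₀.trans (map_zero _).symm), map_zero]
    obtain ⟨G, hG₀G, hG⟩ := zorn_le_nonempty₀ {G | IsPartialGraph (B := B) (F := F) G}
      (fun c hc hchain G hGc => ⟨sSup c, IsPartialGraph.sSup_of_isChain hc hchain ⟨G, hGc⟩,
        fun G' h => le_sSup h⟩) G₀ hG₀
    obtain ⟨f, hf⟩ := hG.1.exists_hom fun U b => IsPartialGraph.exists_mem_of_maximal hF hG b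
    exact ⟨f, sheafHom_ext fun U a => hG.1.eq (hf U _) (hG₀G U ⟨a, rfl⟩)⟩

end Injective

/-! ### Flasque resolutions of the constant sheaf on a manifold -/

section Chart

variable {X Y : Type*} [TopologicalSpace X] [TopologicalSpace Y] (φ : OpenPartialHomeomorph X Y)

/-- The open subset of the source of a chart corresponding to an open subset of the model space. -/
def chartPreimage (V : Opens Y) : Opens X :=
  ⟨φ.source ∩ φ ⁻¹' V, φ.isOpen_inter_preimage V.isOpen⟩

lemma chartPreimage_mono : Monotone (chartPreimage φ) := fun _ _ h _ hx => ⟨hx.1, h hx.2⟩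

lemma exists_chartPreimage_eq {W : Opens X} (hW : (W : Set X) ⊆ φ.source) :
    ∃ V : Opens Y, (V : Set Y) ⊆ φ.target ∧ chartPreimage φ V = W := by
  refine ⟨⟨_, φ.symm.isOpen_inter_preimage W.isOpen⟩, fun y hy => hy.1, Opens.ext ?_⟩
  ext x
  constructor
  · rintro ⟨hx, -, hxW⟩
    simpa [φ.left_inv hx] using hxW
  · intro hx
    exact ⟨hW hx, φ.map_source (hW hx), by simpa [φ.left_inv (hW hx)] using hx⟩

namespace SupportedComplex

variable {R : Type*} [Ring R] (S : SupportedComplex.{u} R X)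

/-- The same complex, with the elements vanishing on the open subsets of a chart of `X`. -/
abbrev onChart : SupportedComplex.{u} R Y where
  Sec := S.Sec
  d := S.d
  d_d := S.d_d
  vanishing p V := S.vanishing p (chartPreimage φ V)
  d_mem := S.d_mem
  anti h := S.anti (chartPreimage_mono φ h)
  mem_sSup {_} 𝒰 x hx := S.anti (U := chartPreimage φ (sSup 𝒰)) (fun y hy => by
      obtain ⟨U, hU, hyU⟩ := Opens.mem_sSup.1 hy.2
      exact Opens.mem_sSup.2 ⟨_, ⟨U, hU, rfl⟩, hy.1, hyU⟩)
    (S.mem_sSup (chartPreimage φ '' 𝒰) (Set.forall_mem_image.2 hx))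
  inf_le {_ U V} := (S.anti (fun _ hx => ⟨hx.1.1, hx.1.2, hx.2.2⟩ :
    chartPreimage φ U ⊓ chartPreimage φ V ≤ chartPreimage φ (U ⊓ V))).trans S.inf_le
  glue U hU := S.glue _ ((chartPreimage_mono φ).comp hU)

lemma vanishingNear_onChart {y : Y} (hy : y ∈ φ.target) (p : ℤ) :
    (S.onChart φ).vanishingNear p {y} = S.vanishingNear p {φ.symm y} := by
  ext s
  constructor
  · rintro ⟨V, hV, hs⟩
    refine ⟨chartPreimage φ V, Set.singleton_subset_iff.2 ⟨φ.map_target hy, ?_⟩, hs⟩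
    simpa [φ.right_inv hy] using hV
  · rintro ⟨U, hU, hs⟩
    refine ⟨⟨_, φ.symm.isOpen_inter_preimage U.isOpen⟩,
      Set.singleton_subset_iff.2 ⟨hy, hU rfl⟩, S.anti ?_ hs⟩
    rintro x ⟨hx, -, hxU⟩
    simpa [φ.left_inv hx] using hxU

variable {S} in
lemma IsConstResolution.onChart {O : Set X} {e : S.Sec 0} (hS : S.IsConstResolution O e)
    (hφ : φ.source ⊆ O) : (S.onChart φ).IsConstResolution φ.target e where
  eq_zero := hS.eq_zero
  d_e := hS.d_e
  eq_zero_of_smul_mem y hy c hc :=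
    hS.eq_zero_of_smul_mem _ (hφ (φ.map_target hy)) c (by rwa [← S.vanishingNear_onChart φ hy])
  exists_sub_smul_mem y hy s hs := by
    rw [S.vanishingNear_onChart φ hy]
    exact hS.exists_sub_smul_mem _ (hφ (φ.map_target hy)) s
      (by rwa [mem_cocyclesNear, ← S.vanishingNear_onChart φ hy])
  acyclicNear hop hpq hp y hy s hs := by
    rw [mem_cocyclesNear, S.vanishingNear_onChart φ hy] at hs
    rw [mem_coboundariesNear, S.vanishingNear_onChart φ hy]
    exact mem_coboundariesNear.1 (hS.acyclicNear hop hpq hp _ (hφ (φ.map_target hy)) hs)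

variable {S} in
theorem IsConstResolution.exists_sub_d_mem_vanishing_of_chart [IsArtinianRing R] {ι : Type*}
    [Finite ι] {O : Set X} {e : S.Sec 0} (hS : S.IsConstResolution O e)
    (φ : OpenPartialHomeomorph X (ι → ℝ)) (hφ : φ.source ⊆ O) {o p q : ℤ} (hop : o + 1 = p)
    (hpq : p + 1 = q) (hp : 1 ≤ p) (hι : Nat.card ι ≤ p) {W : Opens X}
    (hW : (W : Set X) ⊆ φ.source) {s : S.Sec p} (hs : S.d p q s ∈ S.vanishing q W) :
    ∃ y, s - S.d o p y ∈ S.vanishing p W := by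
  obtain ⟨V, hV, rfl⟩ := exists_chartPreimage_eq φ hW
  exact (hS.onChart φ hφ).exists_sub_d_mem_vanishing hop hpq hp hι hV hs

end SupportedComplex

end Chart

section Constant

open Opposite

variable {k : Type u} [Field k] {X : TopCat.{u}}

/-- The constant sheaf associated with a vector space. -/
abbrev constSheafOf (X : TopCat.{u}) (V : ModuleCat.{u} k) : Sh k X :=
  (constantSheaf (Opens.grothendieckTopology X) (ModuleCat.{u} k)).obj V

/-- The constant sections of a constant sheaf. -/
def constSec (X : TopCat.{u}) (V : ModuleCat.{u} k) (U : Opens X) :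
    V →ₗ[k] sec (constSheafOf X V) U :=
  ((toSheafify (Opens.grothendieckTopology X) ((Functor.const _).obj V)).app (op U)).hom

lemma res_constSec (V : ModuleCat.{u} k) {U W : Opens X} (h : W ≤ U) (v : V) :
    res (constSheafOf X V) h (constSec X V U v) = constSec X V W v :=
  congr($((toSheafify (Opens.grothendieckTopology X)
    ((Functor.const _).obj V)).naturality (homOfLE h).op).hom v).symm

lemma exists_constSec_eq (V : ModuleCat.{u} k) {U : Opens X} (s : sec (constSheafOf X V) U) {x : X}
    (hx : x ∈ U) :
    ∃ W : Opens X, ∃ h : W ≤ U, x ∈ W ∧ ∃ v, constSec X V W v = res (constSheafOf X V) h s := by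
  obtain ⟨W, i, ⟨v, hv⟩, hxW⟩ := Presheaf.imageSieve_mem (Opens.grothendieckTopology X)
    (toSheafify (Opens.grothendieckTopology X) ((Functor.const _).obj V)) s x hx
  exact ⟨W, leOfHom i, hxW, v, hv⟩

lemma constSec_injective (V : ModuleCat.{u} k) {U : Opens X} {x : X} (hx : x ∈ U) :
    Function.Injective (constSec X V U) := by
  intro v v' h
  obtain ⟨_, _, hW, _⟩ := Presheaf.equalizerSieve_mem (Opens.grothendieckTopology X)
    (toSheafify (Opens.grothendieckTopology X) ((Functor.const _).obj V)) (X := op U) v v' h x hx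
  exact hW

lemma smul_constSec_one (U : Opens X) (c : k) :
    c • constSec X (ModuleCat.of k k) U (1 : k) = constSec X (ModuleCat.of k k) U c := by
  rw [← map_smul]
  exact congr(constSec X (ModuleCat.of k k) U $(mul_one c))

end Constant

section FlasqueResolution

variable {k : Type u} [Field k] {X : TopCat.{u}}

lemma exists_eq_zero_near_of_res_eq_zero (F : Sh k X) [TopCat.Presheaf.IsFlasque F.obj]
    {U V : Opens X} {s : sec F ⊤} (hs : res F (le_top : U ⊓ V ≤ ⊤) s = 0) :
    ∃ t, res F (le_top : U ≤ ⊤) t = 0 ∧ res F (le_top : V ≤ ⊤) (s - t) = 0 := by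
  obtain ⟨r, hrU, hrV⟩ := exists_glue_sup F (0 : sec F U) (res F (le_top : V ≤ ⊤) s)
    (by rw [map_zero, res_res, hs])
  obtain ⟨t, rfl⟩ := res_surjective F le_top r
  rw [res_res] at hrU hrV
  exact ⟨t, hrU, by rw [map_sub, hrV, sub_self]⟩

lemma exists_res_eq_of_monotone (F : Sh k X) [TopCat.Presheaf.IsFlasque F.obj] {U : ℕ → Opens X}
    (hU : Monotone U) {s : ℕ → sec F ⊤}
    (hs : ∀ j, res F (le_top : U j ≤ ⊤) (s (j + 1)) = res F le_top (s j)) :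
    ∃ t, ∀ j, res F (le_top : U j ≤ ⊤) t = res F le_top (s j) := by
  have hle : ∀ i j, i ≤ j → res F (le_top : U i ≤ ⊤) (s j) = res F le_top (s i) := by
    intro i j hij
    induction j, hij using Nat.le_induction with
    | base => rfl
    | succ j hij ih => rw [← ih, ← res_res F le_top (hU hij), hs, res_res]
  obtain ⟨r, hr⟩ := exists_glue F U (fun j => res F le_top (s j)) fun i j => by
    rw [res_res, res_res]
    rcases le_total i j with h | h
    · rw [← res_res F le_top inf_le_left, ← hle i j h, res_res]
    · rw [← res_res F le_top (inf_le_right : U i ⊓ U j ≤ _) (s j), ← hle j i h, res_res]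
  obtain ⟨t, rfl⟩ := res_surjective F le_top r
  exact ⟨t, fun j => by rw [← hr j, res_res]⟩

variable (I : CochainComplex (Sh k X) ℤ)

/-- The complex of global sections of a complex of flasque sheaves. -/
abbrev globalSections [∀ p, TopCat.Presheaf.IsFlasque (I.X p).obj] : SupportedComplex.{u} k X where
  Sec p := sec (I.X p) ⊤
  d p q := secMap (I.d p q) ⊤
  d_d p q r x := by rw [← secMap_comp, I.d_comp_d, secMap_zero]
  vanishing p U := LinearMap.ker (res (I.X p) (le_top : U ≤ ⊤))
  d_mem {p U x} q hx := by
    rw [LinearMap.mem_ker] at hx ⊢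
    rw [← secMap_res, hx, map_zero]
  anti {p U V} h x hx := by
    rw [LinearMap.mem_ker] at hx ⊢
    rw [← res_res _ le_top h, hx, map_zero]
  mem_sSup {p} 𝒰 x hx := by
    rw [LinearMap.mem_ker]
    refine sec_ext _ fun y hy => ?_
    obtain ⟨U, hU, hyU⟩ := Opens.mem_sSup.1 hy
    exact ⟨U, le_sSup hU, hyU, by rw [res_res, LinearMap.mem_ker.1 (hx U hU), map_zero]⟩
  inf_le {p U V} s hs := by
    obtain ⟨t, ht, hst⟩ := exists_eq_zero_near_of_res_eq_zero (I.X p) (LinearMap.mem_ker.1 hs)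
    exact Submodule.mem_sup.2 ⟨t, ht, s - t, hst, add_sub_cancel t s⟩
  glue {p} U hU s hs := by
    simp only [LinearMap.mem_ker, map_sub, sub_eq_zero] at hs ⊢
    exact exists_res_eq_of_monotone (I.X p) hU hs

/-- A complex `0 → k_X → I⁰ → I¹ → ⋯` whose terms `Iᵖ` are flasque and which is exact. -/
structure IsFlasqueResolution (f : constSheafOf X (ModuleCat.of k k) ⟶ I.X 0) : Prop where
  isFlasque (p : ℤ) : TopCat.Presheaf.IsFlasque (I.X p).obj
  isStrictlyGE : I.IsStrictlyGE 0
  exactAt (p : ℤ) (hp : p ≠ 0) : I.ExactAt p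
  mono : Mono f
  comp_d : f ≫ I.d 0 1 = 0
  exact : (ShortComplex.mk f (I.d 0 1) comp_d).Exact

variable {I} {f : constSheafOf X (ModuleCat.of k k) ⟶ I.X 0}

lemma mem_vanishingNear_globalSections [∀ p, TopCat.Presheaf.IsFlasque (I.X p).obj] {p : ℤ}
    {x : X} {s : sec (I.X p) ⊤} : s ∈ (globalSections I).vanishingNear p {x} ↔
      ∃ U : Opens X, x ∈ U ∧ res (I.X p) (le_top : U ≤ ⊤) s = 0 :=
  exists_congr fun _ => and_congr_left' Set.singleton_subset_iff

lemma IsFlasqueResolution.isConstResolution [∀ p, TopCat.Presheaf.IsFlasque (I.X p).obj]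
    (hI : IsFlasqueResolution I f) :
    (globalSections I).IsConstResolution Set.univ
      (secMap f ⊤ (constSec X (ModuleCat.of k k) ⊤ (1 : k))) where
  eq_zero p hp s := by
    have := hI.isStrictlyGE
    have h : 𝟙 (I.X p) = 0 := (I.isZero_of_isStrictlyGE 0 p hp).eq_of_src _ _
    exact congr(secMap $h ⊤ s)
  d_e q := by
    by_cases hq : q = 1
    · subst hq
      exact (secMap_comp f (I.d 0 1) ⊤ _).symm.trans (by rw [hI.comp_d, secMap_zero])
    · have h : I.d 0 q = 0 := I.shape _ _ fun h => hq (by simpa using h.symm)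
      exact congr(secMap $h ⊤ _)
  eq_zero_of_smul_mem x _ c hc := by
    have := hI.mono
    obtain ⟨U, hxU, hs⟩ := mem_vanishingNear_globalSections.1 hc
    have hf : secMap f U (constSec X (ModuleCat.of k k) U c) = 0 := by
      rw [← smul_constSec_one, map_smul, ← res_constSec _ (le_top : U ≤ ⊤), secMap_res, ← map_smul]
      exact hs
    have hc := secMap_injective f U (hf.trans (map_zero _).symm)
    exact constSec_injective (X := X) _ hxU (hc.trans (map_zero _).symm)
  exists_sub_smul_mem x _ s hs := by
    have := hI.mono
    obtain ⟨U, hxU, hs⟩ := mem_vanishingNear_globalSections.1 hs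
    obtain ⟨t, ht⟩ := exists_secMap_eq_of_exact_of_mono hI.exact (res (I.X 0) (le_top : U ≤ ⊤) s)
      ((secMap_res _ _ _).trans hs)
    obtain ⟨V, hVU, hxV, c, hc⟩ := exists_constSec_eq (ModuleCat.of k k) t hxU
    refine ⟨c, mem_vanishingNear_globalSections.2 ⟨V, hxV, ?_⟩⟩
    rw [map_sub, sub_eq_zero, map_smul, ← secMap_res, res_constSec, ← map_smul,
      smul_constSec_one, hc, secMap_res, ← res_res (I.X 0) le_top hVU]
    exact congr(res (I.X 0) hVU $ht.symm)
  acyclicNear {o p q} hop hpq hp x _ s hs := by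
    obtain ⟨U, hxU, hs⟩ := mem_vanishingNear_globalSections.1 hs
    have hex : (ShortComplex.mk _ _ (I.d_comp_d o p q)).Exact :=
      (I.exactAt_iff' o p q (by simp; lia) (by simp; lia)).1 (hI.exactAt p hp)
    obtain ⟨V, hVU, hxV, t, ht⟩ := exists_secMap_eq_of_exact hex (res (I.X p) (le_top : U ≤ ⊤) s)
      ((secMap_res _ _ _).trans hs) hxU
    obtain ⟨y, rfl⟩ := res_surjective (I.X o) (le_top : V ≤ ⊤) t
    refine SupportedComplex.mem_coboundariesNear.2
      ⟨y, mem_vanishingNear_globalSections.2 ⟨V, hxV, ?_⟩⟩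
    rw [map_sub, sub_eq_zero, ← res_res (I.X p) le_top hVU, ← ht]
    exact secMap_res _ _ _

end FlasqueResolution

section Cycles

variable {k : Type u} [Field k] {X : TopCat.{u}}

lemma isLocallyFlasque_of_discreteTopology [DiscreteTopology X] (F : Sh k X) :
    IsLocallyFlasque F := by
  refine fun x => ⟨⟨{x}, isOpen_discrete _⟩, rfl, fun W hW s => ?_⟩
  by_cases hx : x ∈ W
  · have hle : ⟨{x}, isOpen_discrete _⟩ ≤ W := Set.singleton_subset_iff.2 hx
    exact ⟨res F hle s, by rw [res_res, res_self]⟩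
  · exact ⟨0, sec_ext F fun y hy => (hx (hW hy ▸ hy)).elim⟩

variable {I : CochainComplex (Sh k X) ℤ} {f : constSheafOf X (ModuleCat.of k k) ⟶ I.X 0}

lemma IsFlasqueResolution.res_cycles_surjective (hI : IsFlasqueResolution I f) {n : ℕ} (hn : 0 < n)
    (φ : OpenPartialHomeomorph X (Fin n → ℝ)) {S W : Opens X} (hS : (S : Set X) ⊆ φ.source)
    (hW : W ≤ S) : Function.Surjective (res (I.cycles n) hW) := by
  intro s
  have := hI.isFlasque
  obtain ⟨s', hs'⟩ := res_surjective (I.X n) le_top (secMap (I.iCycles n) W s)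
  have hds' : res (I.X (n + 1)) (le_top : W ≤ ⊤) (secMap (I.d n (n + 1)) ⊤ s') = 0 := by
    rw [← secMap_res, hs', ← secMap_comp, I.iCycles_d, secMap_zero]
  obtain ⟨(y : sec (I.X (n - 1)) ⊤), hy⟩ := hI.isConstResolution.exists_sub_d_mem_vanishing_of_chart
    φ (Set.subset_univ _) (o := n - 1) (sub_add_cancel _ _) rfl (by lia) (by simp)
    (fun _ hx => hS (hW hx)) hds'
  have hsy : res (I.X n) (le_top : W ≤ ⊤) s' = res (I.X n) le_top (secMap (I.d (n - 1) n) ⊤ y) := by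
    rw [← sub_eq_zero, ← map_sub]
    exact hy
  obtain ⟨t, ht⟩ := exists_secMap_iCycles_eq I (p := n) (q := n + 1) rfl
    (res (I.X n) (le_top : S ≤ ⊤) (secMap (I.d (n - 1) n) ⊤ y))
    (by rw [secMap_res, ← secMap_comp, I.d_comp_d, secMap_zero, map_zero])
  refine ⟨t, secMap_injective (I.iCycles n) W ?_⟩
  rw [secMap_res, ht, res_res, ← hsy, hs']

theorem IsFlasqueResolution.isLocallyFlasque_cycles (hI : IsFlasqueResolution I f) (n : ℕ)
    [ChartedSpace (EuclideanSpace ℝ (Fin n)) X] : IsLocallyFlasque (I.cycles n) := by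
  rcases Nat.eq_zero_or_pos n with rfl | hn
  · have := ChartedSpace.discreteTopology (H := EuclideanSpace ℝ (Fin 0)) (M := X)
    exact isLocallyFlasque_of_discreteTopology _
  · intro x
    let φ : OpenPartialHomeomorph X (Fin n → ℝ) := (chartAt (EuclideanSpace ℝ (Fin n)) x)
      |>.transHomeomorph (EuclideanSpace.equiv (Fin n) ℝ).toHomeomorph
    exact ⟨⟨φ.source, φ.open_source⟩, mem_chart_source (EuclideanSpace ℝ (Fin n)) x,
      fun W hW => hI.res_cycles_surjective hn φ subset_rfl hW⟩

end Cycles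

section InjectiveDimension

section Abelian

variable {C : Type*} [Category* C] [Abelian C]

lemma exists_mono_exact_cochainComplex {Z : C} (R : InjectiveResolution Z) :
    ∃ (f : Z ⟶ R.cochainComplex.X 0) (w : f ≫ R.cochainComplex.d 0 1 = 0),
      Mono f ∧ (ShortComplex.mk f (R.cochainComplex.d 0 1) w).Exact := by
  let f : ((CochainComplex.single₀ C).obj Z).X 0 ⟶ R.cochainComplex.X 0 :=
    R.ι.f 0 ≫ (R.cochainComplexXIso 0 0 rfl).inv
  have hd := R.cochainComplex_d 0 1 0 1 rfl rfl
  have w : f ≫ R.cochainComplex.d 0 1 = 0 := by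
    rw [hd, Category.assoc, Iso.inv_hom_id_assoc, R.ι_f_zero_comp_complex_d_assoc, zero_comp]
  have : Mono (R.ι.f 0) := inferInstance
  refine ⟨f, w, mono_comp (R.ι.f 0) (R.cochainComplexXIso 0 0 rfl).inv, ?_⟩
  let e : ShortComplex.mk _ _ R.ι_f_zero_comp_complex_d ≅
      ShortComplex.mk f (R.cochainComplex.d 0 1) w :=
    ShortComplex.isoMk (Iso.refl _) (R.cochainComplexXIso 0 0 rfl).symm
      (R.cochainComplexXIso 1 1 rfl).symm (by simp [f]) (by simp [hd])
  exact ShortComplex.exact_of_iso e R.exact₀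

variable [HasDerivedCategory.{w} C]

lemma eq_zero_of_isGE_of_isKInjective {Y : DerivedCategory C} {n : ℤ} [Y.IsGE (n + 1)]
    {E : CochainComplex C ℤ} [E.IsKInjective] [E.IsStrictlyLE n]
    (f : Y ⟶ DerivedCategory.Q.obj E) : f = 0 := by
  obtain ⟨K, _, ⟨e⟩⟩ := DerivedCategory.exists_iso_Q_obj_of_isGE Y (n + 1)
  suffices ∀ g : DerivedCategory.Q.obj K ⟶ DerivedCategory.Q.obj E, g = 0 by
    rw [← cancel_epi e.inv, this (e.inv ≫ f), comp_zero]
  intro g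
  let α := DerivedCategory.quotientCompQhIso C
  obtain ⟨h, hh⟩ := (CochainComplex.IsKInjective.Qh_map_bijective
    ((HomotopyCategory.quotient _ _).obj K) E).surjective (α.hom.app K ≫ g ≫ α.inv.app E)
  obtain ⟨h, rfl⟩ := (HomotopyCategory.quotient _ _).map_surjective h
  have h0 : h = 0 := by
    ext i
    by_cases hi : n < i
    · exact (CochainComplex.isZero_of_isStrictlyLE E n i hi).eq_of_tgt _ _
    · exact (CochainComplex.isZero_of_isStrictlyGE K (n + 1) i (by lia)).eq_of_src _ _
  rw [h0, Functor.map_zero, Functor.map_zero] at hh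
  rw [← cancel_epi (α.hom.app K), ← cancel_mono (α.inv.app E), Category.assoc, ← hh]
  simp

lemma eq_zero_of_isGE_of_injective_cycles {Z : C} (R : InjectiveResolution Z) (n : ℕ)
    [Injective (R.cochainComplex.cycles n)] {Y : DerivedCategory C} [Y.IsGE ((n : ℤ) + 1)]
    (g : Y ⟶ (DerivedCategory.singleFunctor C 0).obj Z) : g = 0 := by
  let I := R.cochainComplex
  let E := I.truncLE n
  have (i : ℤ) : Injective (E.X i) := by
    rcases lt_trichotomy i n with h | rfl | h
    · exact Injective.of_iso (I.truncLEXIso n i h).symm inferInstance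
    · exact Injective.of_iso (I.truncLEXIsoCycles n).symm inferInstance
    · exact IsZero.injective (CochainComplex.isZero_of_isStrictlyLE E n i h)
  have : E.IsStrictlyGE 0 := (CochainComplex.isStrictlyGE_iff _ _).2 fun i hi =>
    IsZero.of_iso (I.isZero_of_isStrictlyGE 0 i hi) (I.truncLEXIso n i (by lia))
  have : E.IsKInjective := CochainComplex.isKInjective_of_injective E 0
  have : I.IsLE n := I.isLE_of_le 0 n (by lia)
  let e : (DerivedCategory.singleFunctor C 0).obj Z ≅ DerivedCategory.Q.obj E :=
    (DerivedCategory.singleFunctorIsoCompQ _ 0).app _ ≪≫ asIso (DerivedCategory.Q.map R.ι') ≪≫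
      (asIso (DerivedCategory.Q.map (I.ιTruncLE n))).symm
  rw [← cancel_mono e.hom, eq_zero_of_isGE_of_isKInjective (n := n) (g ≫ e.hom), zero_comp]

end Abelian

variable {k : Type u} [Field k] {X : TopCat.{u}}

lemma exists_isFlasqueResolution (R : InjectiveResolution (constSheaf k X)) :
    ∃ f, IsFlasqueResolution R.cochainComplex f := by
  obtain ⟨f, w, hf, hfw⟩ := exists_mono_exact_cochainComplex R
  exact ⟨f, { isFlasque := fun p => isFlasque_of_injective _
              isStrictlyGE := inferInstance
              exactAt := fun p hp => by
                rcases lt_or_gt_of_ne hp with h | h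
                · exact CochainComplex.exactAt_of_isGE _ 0 p h
                · exact CochainComplex.exactAt_of_isLE _ 0 p h
              mono := hf
              comp_d := w
              exact := hfw }⟩

theorem hom_constObj_eq_zero [HasDerivedCategory.{w} (Sh k X)] (n : ℕ)
    [ChartedSpace (EuclideanSpace ℝ (Fin n)) X] {Y : DerivedCategory (Sh k X)}
    [Y.IsGE ((n : ℤ) + 1)] (g : Y ⟶ constObj k X) : g = 0 := by
  let R : InjectiveResolution (constSheaf k X) := InjectiveResolution.of _
  obtain ⟨f, hf⟩ := exists_isFlasqueResolution R
  have := (hf.isLocallyFlasque_cycles n).injective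
  exact eq_zero_of_isGE_of_injective_cycles R n g

end InjectiveDimension

/-! ### Tensor products of complexes and the Künneth formula -/

open MonoidalCategory hiding tensorObj
open HomologicalComplex

section Retract

section Preadditive

variable {C : Type*} [Category* C] [Preadditive C]

lemma mono_of_sum_eq_id {ι : Type*} (s : Finset ι) {A B : C} (f : A ⟶ B) {A' B' : ι → C}
    (f' : ∀ i, A' i ⟶ B' i) [∀ i, Mono (f' i)] (a : ∀ i, A ⟶ A' i) (a' : ∀ i, A' i ⟶ A)
    (b : ∀ i, B ⟶ B' i) (h : ∀ i, a i ≫ f' i = f ≫ b i) (hs : ∑ i ∈ s, a i ≫ a' i = 𝟙 A) :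
    Mono f := by
  refine Preadditive.mono_of_cancel_zero _ fun {T} g hg => ?_
  have hi (i) : g ≫ a i = 0 := by
    rw [← cancel_mono (f' i), Category.assoc, h, reassoc_of% hg, zero_comp, zero_comp]
  rw [← Category.comp_id g, ← hs, Preadditive.comp_sum]
  exact Finset.sum_eq_zero fun i _ => by rw [reassoc_of% hi, zero_comp]

lemma epi_of_sum_eq_id {ι : Type*} (s : Finset ι) {A B : C} (f : A ⟶ B) {A' B' : ι → C}
    (f' : ∀ i, A' i ⟶ B' i) [∀ i, Epi (f' i)] (a' : ∀ i, A' i ⟶ A) (b : ∀ i, B ⟶ B' i)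
    (b' : ∀ i, B' i ⟶ B) (h : ∀ i, f' i ≫ b' i = a' i ≫ f) (hs : ∑ i ∈ s, b i ≫ b' i = 𝟙 B) :
    Epi f := by
  refine Preadditive.epi_of_cancel_zero _ fun {T} g hg => ?_
  have hi (i) : b' i ≫ g = 0 := by
    rw [← cancel_epi (f' i), reassoc_of% h, hg, comp_zero, comp_zero]
  rw [← Category.id_comp g, ← hs, Preadditive.sum_comp]
  exact Finset.sum_eq_zero fun i _ => by rw [Category.assoc, hi, comp_zero]

instance : (ShortComplex.π₁ (C := C)).Additive where

instance : (ShortComplex.π₂ (C := C)).Additive where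

instance : (ShortComplex.π₃ (C := C)).Additive where

lemma sum_comp_eq_id_of_τ {ι : Type*} (s : Finset ι) {S : ShortComplex C}
    {S' : ι → ShortComplex C} (a : ∀ i, S ⟶ S' i) (a' : ∀ i, S' i ⟶ S)
    (h₁ : ∑ i ∈ s, (a i).τ₁ ≫ (a' i).τ₁ = 𝟙 S.X₁) (h₂ : ∑ i ∈ s, (a i).τ₂ ≫ (a' i).τ₂ = 𝟙 S.X₂)
    (h₃ : ∑ i ∈ s, (a i).τ₃ ≫ (a' i).τ₃ = 𝟙 S.X₃) : ∑ i ∈ s, a i ≫ a' i = 𝟙 S :=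
  ShortComplex.hom_ext _ _ ((ShortComplex.π₁.map_sum _ _).trans h₁)
    ((ShortComplex.π₂.map_sum _ _).trans h₂) ((ShortComplex.π₃.map_sum _ _).trans h₃)

end Preadditive

variable {C : Type*} [Category* C] [Abelian C]

lemma sum_homologyMap_eq_id {ι : Type*} (s : Finset ι) {S : ShortComplex C}
    {S' : ι → ShortComplex C} (a : ∀ i, S ⟶ S' i) (a' : ∀ i, S' i ⟶ S)
    (hs : ∑ i ∈ s, a i ≫ a' i = 𝟙 S) :
    ∑ i ∈ s, ShortComplex.homologyMap (a i) ≫ ShortComplex.homologyMap (a' i) =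
      𝟙 S.homology := by
  simp_rw [← ShortComplex.homologyMap_comp, ← ShortComplex.homologyMap_id, ← hs]
  exact ((ShortComplex.homologyFunctor C).map_sum _ _).symm

lemma shortExact_of_sum_eq_id {ι : Type*} (s : Finset ι) {S : ShortComplex C}
    {S' : ι → ShortComplex C} (hS' : ∀ i, (S' i).ShortExact) (a : ∀ i, S ⟶ S' i)
    (a' : ∀ i, S' i ⟶ S) (hs : ∑ i ∈ s, a i ≫ a' i = 𝟙 S) : S.ShortExact := by
  have (i : ι) : Mono (S' i).f := (hS' i).mono_f
  have (i : ι) : Epi (S' i).g := (hS' i).epi_g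
  refine .mk' ?_ ?_ ?_
  · rw [ShortComplex.exact_iff_isZero_homology, IsZero.iff_id_eq_zero,
      ← sum_homologyMap_eq_id s a a' hs]
    exact Finset.sum_eq_zero fun i _ => by
      rw [((ShortComplex.exact_iff_isZero_homology _).1 (hS' i).exact).eq_of_tgt
        (ShortComplex.homologyMap (a i)) 0, zero_comp]
  · exact mono_of_sum_eq_id s _ (fun i => (S' i).f) (fun i => (a i).τ₁) (fun i => (a' i).τ₁)
      (fun i => (a i).τ₂) (fun i => (a i).comm₁₂)
      ((ShortComplex.π₁.map_sum _ _).symm.trans congr(($hs).τ₁))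
  · exact epi_of_sum_eq_id s _ (fun i => (S' i).g) (fun i => (a' i).τ₂) (fun i => (a i).τ₃)
      (fun i => (a' i).τ₃) (fun i => (a' i).comm₂₃.symm)
      ((ShortComplex.π₃.map_sum _ _).symm.trans congr(($hs).τ₃))

end Retract

section TensorZero

variable {C : Type*} [Category* C] [Preadditive C] [MonoidalCategory C] [MonoidalPreadditive C]

lemma isZero_tensor_left {A : C} (hA : IsZero A) (B : C) : IsZero (A ⊗ B) := by
  rw [IsZero.iff_id_eq_zero, ← id_whiskerRight, hA.eq_of_src (𝟙 A) 0,
    MonoidalPreadditive.zero_whiskerRight]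

lemma isZero_tensor_right (A : C) {B : C} (hB : IsZero B) : IsZero (A ⊗ B) := by
  rw [IsZero.iff_id_eq_zero, ← whiskerLeft_id, hB.eq_of_src (𝟙 B) 0,
    MonoidalPreadditive.whiskerLeft_zero]

lemma isZero_tensor_of_isStrictlyGE {K D : CochainComplex C ℤ} {a b i j : ℤ} [K.IsStrictlyGE a]
    [D.IsStrictlyGE b] (h : i < a ∨ j < b) : IsZero (K.X i ⊗ D.X j) :=
  h.elim (fun h => isZero_tensor_left (K.isZero_of_isStrictlyGE a i h) _)
    fun h => isZero_tensor_right _ (D.isZero_of_isStrictlyGE b j h)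

end TensorZero

section Tensor

variable {C : Type*} [Category* C] [Preadditive C] [MonoidalCategory C] [MonoidalPreadditive C]
  [∀ K₁ K₂ : CochainComplex C ℤ, HasTensor K₁ K₂]

lemma tensorObj_hom_ext {K D : CochainComplex C ℤ} {m : ℤ} {A : C}
    {f g : (tensorObj K D).X m ⟶ A}
    (h : ∀ (p q : ℤ) (hpq : p + q = m),
      ιTensorObj K D p q m hpq ≫ f = ιTensorObj K D p q m hpq ≫ g) : f = g :=
  mapBifunctor.hom_ext h

/-- The projection of the tensor product of two complexes onto the summand of bidegree `(p, q)`. -/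
def tensorProj (K D : CochainComplex C ℤ) (p q m : ℤ) (h : p + q = m) :
    (tensorObj K D).X m ⟶ K.X p ⊗ D.X q :=
  mapBifunctorDesc fun i j (hij : i + j = m) =>
    if hi : i = p then eqToHom (by obtain rfl : j = q := by lia
                                   rw [hi]; rfl) else 0

lemma ι_tensorProj_self (K D : CochainComplex C ℤ) (p q m : ℤ) (h : p + q = m) :
    ιTensorObj K D p q m h ≫ tensorProj K D p q m h = 𝟙 _ := by
  simp [tensorProj]

lemma ι_tensorProj_of_ne (K D : CochainComplex C ℤ) {p q p' q' m : ℤ} (h : p + q = m)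
    (h' : p' + q' = m) (hne : p' ≠ p) :
    ιTensorObj K D p' q' m h' ≫ tensorProj K D p q m h = 0 := by
  simp [tensorProj, hne]

lemma sum_tensorProj_ι (K D : CochainComplex C ℤ) (a : ℤ) [K.IsStrictlyGE a] [D.IsStrictlyGE 0]
    {m n : ℤ} (hmn : m ≤ n) :
    ∑ p ∈ Finset.Icc a n, tensorProj K D p (m - p) m (by lia) ≫
      ιTensorObj K D p (m - p) m (by lia) = 𝟙 _ := by
  refine tensorObj_hom_ext fun i j hij => ?_
  by_cases hi : i ∈ Finset.Icc a n
  · rw [Preadditive.comp_sum, Finset.sum_eq_single_of_mem i hi]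
    · obtain rfl : j = m - i := by lia
      rw [reassoc_of% ι_tensorProj_self K D, Category.comp_id]
    · intro p _ hp
      rw [reassoc_of% ι_tensorProj_of_ne K D _ hij hp.symm, zero_comp]
  · rw [Finset.mem_Icc] at hi
    exact (isZero_tensor_of_isStrictlyGE (a := a) (b := 0) (by lia)).eq_of_src _ _

/-- The morphism `f ⊗ D` of tensor products of complexes. -/
def tensorRightMap {K K' : CochainComplex C ℤ} (f : K ⟶ K') (D : CochainComplex C ℤ) :
    tensorObj K D ⟶ tensorObj K' D := tensorHom f (𝟙 D)

lemma ι_tensorRightMap {K K' : CochainComplex C ℤ} (f : K ⟶ K') (D : CochainComplex C ℤ)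
    (p q m : ℤ) (h : p + q = m) :
    ιTensorObj K D p q m h ≫ (tensorRightMap f D).f m =
      f.f p ▷ D.X q ≫ ιTensorObj K' D p q m h :=
  (ι_mapBifunctorMap f (𝟙 D) (curriedTensor C) (ComplexShape.up ℤ) p q m h).trans (by simp)

lemma tensorRightMap_proj {K K' : CochainComplex C ℤ} (f : K ⟶ K') (D : CochainComplex C ℤ)
    (p q m : ℤ) (h : p + q = m) :
    (tensorRightMap f D).f m ≫ tensorProj K' D p q m h =
      tensorProj K D p q m h ≫ f.f p ▷ D.X q := by
  refine tensorObj_hom_ext fun i j hij => ?_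
  rw [reassoc_of% ι_tensorRightMap f D i j m hij]
  by_cases hi : i = p
  · obtain rfl := hi
    obtain rfl : j = q := by lia
    rw [reassoc_of% ι_tensorProj_self K D i j m hij, ι_tensorProj_self, Category.comp_id]
  · rw [reassoc_of% ι_tensorProj_of_ne K D h hij hi, ι_tensorProj_of_ne _ _ _ _ hi, comp_zero,
      zero_comp]

lemma tensorRightMap_id (K D : CochainComplex C ℤ) : tensorRightMap (𝟙 K) D = 𝟙 _ := by
  ext m : 1
  refine tensorObj_hom_ext fun i j hij => ?_
  simp [ι_tensorRightMap]

lemma tensorRightMap_comp {K K' K'' : CochainComplex C ℤ} (f : K ⟶ K') (g : K' ⟶ K'')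
    (D : CochainComplex C ℤ) :
    tensorRightMap (f ≫ g) D = tensorRightMap f D ≫ tensorRightMap g D := by
  ext m : 1
  refine tensorObj_hom_ext fun i j hij => ?_
  rw [comp_f, reassoc_of% ι_tensorRightMap f D i j m hij, ι_tensorRightMap, ι_tensorRightMap,
    comp_f, comp_whiskerRight, Category.assoc]

lemma tensorRightMap_zero (K K' D : CochainComplex C ℤ) :
    tensorRightMap (0 : K ⟶ K') D = 0 := by
  ext m : 1
  refine tensorObj_hom_ext fun i j hij => ?_
  simp [ι_tensorRightMap]

/-- The functor `- ⊗ D` on complexes. -/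
abbrev tensorRightFunctor (D : CochainComplex C ℤ) : CochainComplex C ℤ ⥤ CochainComplex C ℤ where
  obj K := tensorObj K D
  map f := tensorRightMap f D
  map_id K := tensorRightMap_id K D
  map_comp f g := tensorRightMap_comp f g D

instance (D : CochainComplex C ℤ) : (tensorRightFunctor D).PreservesZeroMorphisms where
  map_zero K K' := tensorRightMap_zero K K' D

lemma isStrictlyGE_tensorObj (K D : CochainComplex C ℤ) (a b : ℤ) [K.IsStrictlyGE a]
    [D.IsStrictlyGE b] {c : ℤ} (h : a + b = c) :
    CochainComplex.IsStrictlyGE (tensorObj K D) c := by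
  rw [CochainComplex.isStrictlyGE_iff]
  intro m hm
  rw [IsZero.iff_id_eq_zero]
  exact tensorObj_hom_ext fun i j hij =>
    (isZero_tensor_of_isStrictlyGE (a := a) (b := b) (by lia)).eq_of_src _ _

end Tensor

section TensorExact

variable {C : Type*} [Category* C] [Abelian C] [MonoidalCategory C] [MonoidalPreadditive C]
  [∀ K₁ K₂ : CochainComplex C ℤ, HasTensor K₁ K₂]

lemma shortExact_map_tensorRightFunctor [∀ X : C, PreservesFiniteLimits (tensorRight X)]
    [∀ X : C, PreservesFiniteColimits (tensorRight X)] {S : ShortComplex (CochainComplex C ℤ)}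
    (hS : S.ShortExact) (D : CochainComplex C ℤ) (a : ℤ) [S.X₁.IsStrictlyGE a]
    [S.X₂.IsStrictlyGE a] [S.X₃.IsStrictlyGE a] [D.IsStrictlyGE 0] :
    (S.map (tensorRightFunctor D)).ShortExact := by
  refine shortExact_of_degreewise_shortExact _ fun m =>
    shortExact_of_sum_eq_id (Finset.Icc a m)
      (fun p => (hS.map_of_exact (eval C _ p)).map_of_exact (tensorRight (D.X (m - p))))
      (fun p =>
        { τ₁ := tensorProj _ _ p (m - p) m (by lia)
          τ₂ := tensorProj _ _ p (m - p) m (by lia)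
          τ₃ := tensorProj _ _ p (m - p) m (by lia)
          comm₁₂ := (tensorRightMap_proj _ _ _ _ _ _).symm
          comm₂₃ := (tensorRightMap_proj _ _ _ _ _ _).symm })
      (fun p =>
        { τ₁ := ιTensorObj _ _ p (m - p) m (by lia)
          τ₂ := ιTensorObj _ _ p (m - p) m (by lia)
          τ₃ := ιTensorObj _ _ p (m - p) m (by lia)
          comm₁₂ := ι_tensorRightMap _ _ _ _ _ _
          comm₂₃ := ι_tensorRightMap _ _ _ _ _ _ })
      (sum_comp_eq_id_of_τ _ _ _ (sum_tensorProj_ι S.X₁ D a le_rfl)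
        (sum_tensorProj_ι S.X₂ D a le_rfl) (sum_tensorProj_ι S.X₃ D a le_rfl))

end TensorExact

section ZeroDifferential

variable {C : Type*} [Category* C] [Preadditive C] [MonoidalCategory C] [MonoidalPreadditive C]

/-- The complex `A ⊗ D[-p]`, which is the summand of `K ⊗ D` belonging to `A = K.X p` when `K` has
zero differentials. -/
abbrev tensorSummand (A : C) (D : CochainComplex C ℤ) (p : ℤ) : CochainComplex C ℤ :=
  ((tensorLeft A).mapHomologicalComplex (.up ℤ)).obj (D⟦-p⟧)

lemma tensorSummand_d (A : C) (D : CochainComplex C ℤ) (p i j : ℤ) :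
    (tensorSummand A D p).d i j = p.negOnePow • A ◁ D.d (i + -p) (j + -p) :=
  ((tensorLeft A).map_units_smul _ _).trans (by rw [Int.negOnePow_neg]; rfl)

/-- The morphism `f ⊗ D[-p]`. -/
abbrev tensorSummandMap {A B : C} (f : A ⟶ B) (D : CochainComplex C ℤ) (p : ℤ) :
    tensorSummand A D p ⟶ tensorSummand B D p :=
  (NatTrans.mapHomologicalComplex ((tensoringLeft C).map f) (.up ℤ)).app (D⟦-p⟧)

variable [∀ K₁ K₂ : CochainComplex C ℤ, HasTensor K₁ K₂]

lemma ι_tensor_d {K : CochainComplex C ℤ} (hK : ∀ p q, K.d p q = 0) (D : CochainComplex C ℤ)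
    {p q q' m m' : ℤ} (h : p + q = m) (h' : p + q' = m') (hm : m + 1 = m') :
    ιTensorObj K D p q m h ≫ (tensorObj K D).d m m' =
      (p.negOnePow • K.X p ◁ D.d q q') ≫ ιTensorObj K D p q' m' h' := by
  obtain rfl : q' = q + 1 := by lia
  rw [mapBifunctor.d_eq, Preadditive.comp_add]
  erw [mapBifunctor.ι_D₁, mapBifunctor.ι_D₂]
  rw [mapBifunctor.d₁_eq' _ _ _ _ (show (ComplexShape.up ℤ).Rel p (p + 1) from rfl), hK,
    mapBifunctor.d₂_eq K D (curriedTensor C) (ComplexShape.up ℤ) p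
      (show (ComplexShape.up ℤ).Rel q (q + 1) from rfl) m' h', Linear.units_smul_comp]
  simp

lemma tensor_d_proj {K : CochainComplex C ℤ} (hK : ∀ p q, K.d p q = 0) (D : CochainComplex C ℤ)
    {p q q' m m' : ℤ} (h : p + q = m) (h' : p + q' = m') (hm : m + 1 = m') :
    (tensorObj K D).d m m' ≫ tensorProj K D p q' m' h' =
      tensorProj K D p q m h ≫ (p.negOnePow • K.X p ◁ D.d q q') := by
  refine tensorObj_hom_ext fun i j hij => ?_
  rw [reassoc_of% ι_tensor_d hK D hij (show i + (j + 1) = m' by lia) hm]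
  by_cases hi : i = p
  · obtain rfl := hi
    obtain rfl : j = q := by lia
    obtain rfl : q' = j + 1 := by lia
    rw [reassoc_of% ι_tensorProj_self K D i j m hij, ι_tensorProj_self, Category.comp_id]
  · rw [reassoc_of% ι_tensorProj_of_ne K D h hij hi, ι_tensorProj_of_ne _ _ _ _ hi, comp_zero,
      zero_comp]

variable {K : CochainComplex C ℤ} (hK : ∀ p q, K.d p q = 0) (D : CochainComplex C ℤ)

/-- The inclusion of a summand of `K ⊗ D`, for `K` with zero differentials. -/
def summandι (p : ℤ) : tensorSummand (K.X p) D p ⟶ tensorObj K D where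
  f m := ιTensorObj K D p (m + -p) m (by lia)
  comm' i j hij := by
    rw [tensorSummand_d]
    exact ι_tensor_d hK D _ _ hij

/-- The projection onto a summand of `K ⊗ D`, for `K` with zero differentials. -/
def summandπ (p : ℤ) : tensorObj K D ⟶ tensorSummand (K.X p) D p where
  f m := tensorProj K D p (m + -p) m (by lia)
  comm' i j hij := by
    rw [tensorSummand_d]
    exact (tensor_d_proj hK D _ _ hij).symm

lemma summandι_π_self (p : ℤ) : summandι hK D p ≫ summandπ hK D p = 𝟙 _ := by
  ext m : 1
  exact ι_tensorProj_self K D _ _ _ _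

lemma summandι_π_of_ne {p q : ℤ} (h : p ≠ q) : summandι hK D p ≫ summandπ hK D q = 0 := by
  ext m : 1
  exact ι_tensorProj_of_ne K D (by lia) (by lia) h

lemma summandι_naturality {K' : CochainComplex C ℤ} (hK' : ∀ p q, K'.d p q = 0) (f : K ⟶ K')
    (p : ℤ) : tensorSummandMap (f.f p) D p ≫ summandι hK' D p =
      summandι hK D p ≫ tensorRightMap f D := by
  ext m : 1
  exact (ι_tensorRightMap f D _ _ _ _).symm

lemma summandπ_naturality {K' : CochainComplex C ℤ} (hK' : ∀ p q, K'.d p q = 0) (f : K ⟶ K')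
    (p : ℤ) : summandπ hK D p ≫ tensorSummandMap (f.f p) D p =
      tensorRightMap f D ≫ summandπ hK' D p := by
  ext m : 1
  exact (tensorRightMap_proj f D p (m + -p) m (by lia)).symm

end ZeroDifferential

section HomologySummand

variable {C : Type*} [Category* C] [Abelian C]

lemma homologyMap_eq_id_of_f_eq_id {K : CochainComplex C ℤ} {f : K ⟶ K} {m : ℤ}
    (h : f.f m = 𝟙 _) : homologyMap f m = 𝟙 _ := by
  have hf : cyclesMap f m = 𝟙 _ := by
    rw [← cancel_mono (K.iCycles m), cyclesMap_i, h, Category.comp_id, Category.id_comp]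
  rw [← cancel_epi (K.homologyπ m), homologyπ_naturality, hf, Category.comp_id, Category.id_comp]

variable [MonoidalCategory C] [MonoidalPreadditive C]

section Sum

variable [∀ K₁ K₂ : CochainComplex C ℤ, HasTensor K₁ K₂]
  {K : CochainComplex C ℤ} (hK : ∀ p q, K.d p q = 0) (D : CochainComplex C ℤ)

lemma sum_homologyMap_summandπ_ι (a : ℤ) [K.IsStrictlyGE a] [D.IsStrictlyGE 0] (m : ℤ) :
    ∑ p ∈ Finset.Icc a m, homologyMap (summandπ hK D p) m ≫ homologyMap (summandι hK D p) m =
      𝟙 ((tensorObj K D).homology m) := by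
  rw [← homologyMap_eq_id_of_f_eq_id
    (f := ∑ p ∈ Finset.Icc a m, summandπ hK D p ≫ summandι hK D p)]
  · simp_rw [← homologyMap_comp]
    exact ((homologyFunctor C (.up ℤ) m).map_sum _ _).symm
  · exact ((eval C (.up ℤ) m).map_sum _ _).trans (sum_tensorProj_ι K D a le_rfl)

end Sum

variable [∀ X : C, PreservesFiniteLimits (tensorLeft X)]
  [∀ X : C, PreservesFiniteColimits (tensorLeft X)]

/-- The homology of the summand `A ⊗ D[-p]`. -/
def homologyTensorSummandIso (A : C) (D : CochainComplex C ℤ) (p m : ℤ) :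
    (tensorSummand A D p).homology m ≅ A ⊗ D.homology (m - p) :=
  ((D⟦-p⟧).sc m).mapHomologyIso (tensorLeft A) ≪≫ whiskerLeftIso A
    ((CochainComplex.ShiftSequence.shiftIso C (-p) m (m - p) (by lia)).app D)

lemma homologyMap_tensorSummandMap {A B : C} (f : A ⟶ B) (D : CochainComplex C ℤ) (p m : ℤ) :
    homologyMap (tensorSummandMap f D p) m =
      (homologyTensorSummandIso A D p m).hom ≫ f ▷ D.homology (m - p) ≫
        (homologyTensorSummandIso B D p m).inv := by
  let S := (D⟦-p⟧).sc m
  let s : S.homology ≅ D.homology (m - p) :=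
    (CochainComplex.ShiftSequence.shiftIso C (-p) m (m - p) (by lia)).app D
  have hs : f ▷ S.homology = A ◁ s.hom ≫ f ▷ D.homology (m - p) ≫ B ◁ s.inv := by
    rw [whisker_exchange_assoc, ← MonoidalCategory.whiskerLeft_comp, s.hom_inv_id,
      MonoidalCategory.whiskerLeft_id, Category.comp_id]
  refine (ShortComplex.homologyMap_mapNatTrans S ((tensoringLeft C).map f)).trans
    ((congrArg (fun g => (S.mapHomologyIso (tensorLeft A)).hom ≫ g ≫
      (S.mapHomologyIso (tensorLeft B)).inv) hs).trans ?_)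
  exact (congrArg _ (Category.assoc _ _ _)).trans ((congrArg _ (congrArg _
    (Category.assoc _ _ _))).trans (Category.assoc _ _ _).symm)

variable [∀ K₁ K₂ : CochainComplex C ℤ, HasTensor K₁ K₂]
  {K : CochainComplex C ℤ} (hK : ∀ p q, K.d p q = 0)

include hK in
lemma mono_homologyMap_tensorRightMap [∀ X : C, PreservesFiniteLimits (tensorRight X)]
    {K' : CochainComplex C ℤ} (hK' : ∀ p q, K'.d p q = 0) (f : K ⟶ K') [∀ p, Mono (f.f p)]
    (D : CochainComplex C ℤ) (a : ℤ) [K.IsStrictlyGE a] [D.IsStrictlyGE 0] (m : ℤ) :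
    Mono (homologyMap (tensorRightMap f D) m) := by
  have (p : ℤ) : Mono (homologyMap (tensorSummandMap (f.f p) D p) m) := by
    have : Mono (f.f p ▷ D.homology (m - p)) :=
      inferInstanceAs (Mono ((tensorRight _).map (f.f p)))
    rw [homologyMap_tensorSummandMap]
    infer_instance
  refine mono_of_sum_eq_id (Finset.Icc a m) _
    (fun p => homologyMap (tensorSummandMap (f.f p) D p) m)
    (fun p => homologyMap (summandπ hK D p) m) (fun p => homologyMap (summandι hK D p) m)
    (fun p => homologyMap (summandπ hK' D p) m) (fun p => ?_)
    (sum_homologyMap_summandπ_ι hK D a m)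
  rw [← homologyMap_comp, ← homologyMap_comp, summandπ_naturality]

include hK in
lemma epi_homologyMap_tensorRightMap [∀ X : C, PreservesFiniteColimits (tensorRight X)]
    {K' : CochainComplex C ℤ} (hK' : ∀ p q, K'.d p q = 0) (f : K ⟶ K') [∀ p, Epi (f.f p)]
    (D : CochainComplex C ℤ) (a : ℤ) [K'.IsStrictlyGE a] [D.IsStrictlyGE 0] (m : ℤ) :
    Epi (homologyMap (tensorRightMap f D) m) := by
  have (p : ℤ) : Epi (homologyMap (tensorSummandMap (f.f p) D p) m) := by
    have : Epi (f.f p ▷ D.homology (m - p)) :=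
      inferInstanceAs (Epi ((tensorRight _).map (f.f p)))
    rw [homologyMap_tensorSummandMap]
    infer_instance
  refine epi_of_sum_eq_id (Finset.Icc a m) _
    (fun p => homologyMap (tensorSummandMap (f.f p) D p) m)
    (fun p => homologyMap (summandι hK D p) m) (fun p => homologyMap (summandπ hK' D p) m)
    (fun p => homologyMap (summandι hK' D p) m) (fun p => ?_)
    (sum_homologyMap_summandπ_ι hK' D a m)
  rw [← homologyMap_comp, ← homologyMap_comp, summandι_naturality hK]

attribute [local instance] Abelian.hasFiniteBiproducts

/-- The summands of the homology of `K ⊗ D` in degree `m`, for `K` with zero differentials. -/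
def homologyTensorBicone (D : CochainComplex C ℤ) (a m : ℤ) :
    Bicone fun p : Finset.Icc a m => K.X p ⊗ D.homology (m - p) where
  pt := (tensorObj K D).homology m
  π p := homologyMap (summandπ hK D p) m ≫ (homologyTensorSummandIso _ D p m).hom
  ι p := (homologyTensorSummandIso _ D p m).inv ≫ homologyMap (summandι hK D p) m
  ι_π p q := by
    rw [Category.assoc, ← homologyMap_comp_assoc]
    split_ifs with h
    · subst h
      rw [summandι_π_self, homologyMap_id, Category.id_comp, Iso.inv_hom_id, eqToHom_refl]
    · rw [summandι_π_of_ne hK D fun h' => h (Subtype.ext h'), homologyMap_zero, zero_comp,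
        comp_zero]

include hK in
lemma nonempty_homology_iso_biproduct_of_d_eq_zero (D : CochainComplex C ℤ) (a : ℤ)
    [K.IsStrictlyGE a] [D.IsStrictlyGE 0] (m : ℤ) :
    Nonempty ((tensorObj K D).homology m ≅
      ⨁ fun p : Finset.Icc a m => K.X p ⊗ D.homology (m - p)) := by
  have hB : (homologyTensorBicone hK D a m).IsBilimit := isBilimitOfTotal _ <| by
    refine Eq.trans ?_ (sum_homologyMap_summandπ_ι hK D a m)
    exact (Finset.sum_congr rfl fun p _ => by simp [homologyTensorBicone]).trans
      (Finset.sum_coe_sort (Finset.Icc a m) fun p =>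
        homologyMap (summandπ hK D p) m ≫ homologyMap (summandι hK D p) m)
  exact ⟨biproduct.uniqueUpToIso _ hB⟩

end HomologySummand

attribute [local instance] Abelian.hasFiniteBiproducts

section ZeroComplex

variable {C : Type*} [Category* C] [Abelian C]

/-- The complex with given objects and zero differentials. -/
def zeroComplex (Y : ℤ → C) : CochainComplex C ℤ where
  X := Y
  d _ _ := 0

lemma zeroComplex_d (Y : ℤ → C) (p q : ℤ) : (zeroComplex Y).d p q = 0 := rfl

lemma isStrictlyGE_zeroComplex {Y : ℤ → C} {a : ℤ} (h : ∀ p < a, IsZero (Y p)) :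
    (zeroComplex Y).IsStrictlyGE a :=
  (CochainComplex.isStrictlyGE_iff _ _).2 h

/-- The morphism of complexes with zero differentials given by a family of morphisms. -/
def zeroComplexMap {Y Z : ℤ → C} (f : ∀ p, Y p ⟶ Z p) : zeroComplex Y ⟶ zeroComplex Z where
  f := f
  comm' _ _ _ := comp_zero.trans zero_comp.symm

instance {Y Z : ℤ → C} (f : ∀ p, Y p ⟶ Z p) [∀ p, Mono (f p)] (p : ℤ) :
    Mono ((zeroComplexMap f).f p) :=
  inferInstanceAs (Mono (f p))

instance {Y Z : ℤ → C} (f : ∀ p, Y p ⟶ Z p) [∀ p, Epi (f p)] (p : ℤ) :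
    Epi ((zeroComplexMap f).f p) :=
  inferInstanceAs (Epi (f p))

/-- A morphism to a complex with zero differentials. -/
def toZeroComplex (K : CochainComplex C ℤ) {Y : ℤ → C} (f : ∀ p, K.X p ⟶ Y p)
    (hf : ∀ p q, K.d p q ≫ f q = 0) : K ⟶ zeroComplex Y where
  f := f
  comm' p q _ := comp_zero.trans (hf p q).symm

/-- A morphism from a complex with zero differentials. -/
def ofZeroComplex (K : CochainComplex C ℤ) {Y : ℤ → C} (f : ∀ p, Y p ⟶ K.X p)
    (hf : ∀ p q, f p ≫ K.d p q = 0) : zeroComplex Y ⟶ K where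
  f := f
  comm' p q _ := (hf p q).trans zero_comp.symm

/-- The differential, as a morphism to the shifted complex with zero differentials. -/
def dTo (K : CochainComplex C ℤ) : K ⟶ zeroComplex fun p => K.X (p + 1) :=
  toZeroComplex K (fun p => K.d p (p + 1)) (fun _ _ => K.d_comp_d _ _ _)

/-- The differential, as a morphism from the shifted complex with zero differentials. -/
def dOf (K : CochainComplex C ℤ) : zeroComplex (fun p => K.X (p - 1)) ⟶ K :=
  ofZeroComplex K (fun p => K.d (p - 1) p) (fun _ _ => K.d_comp_d _ _ _)

/-- The differential is homotopic to zero, as a morphism to the shifted complex. -/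
def dToHomotopy (K : CochainComplex C ℤ) : Homotopy (dTo K) 0 where
  hom i j := if h : i = j + 1 then eqToHom (congrArg K.X h) else 0
  zero i j h := dif_neg fun h' => h h'.symm
  comm i := by
    rw [dNext_eq _ (show (ComplexShape.up ℤ).Rel i (i + 1) from rfl),
      prevD_eq _ (show (ComplexShape.up ℤ).Rel (i - 1) i by simp)]
    simp only [dif_pos, zeroComplex_d, comp_zero, add_zero, zero_f]
    exact (Category.comp_id _).symm

/-- The differential is homotopic to zero, as a morphism from the shifted complex. -/
def dOfHomotopy (K : CochainComplex C ℤ) : Homotopy (dOf K) 0 where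
  hom i j := if h : i - 1 = j then eqToHom (congrArg K.X h) else 0
  zero i j h := dif_neg fun h' => h (by simpa using (by lia : j + 1 = i))
  comm i := by
    rw [dNext_eq _ (show (ComplexShape.up ℤ).Rel i (i + 1) from rfl),
      prevD_eq _ (show (ComplexShape.up ℤ).Rel (i - 1) i by simp)]
    simp only [dif_pos, zeroComplex_d, zero_comp, add_zero, zero_add, zero_f]
    exact (Category.id_comp _).symm

/-- The inclusion of the cocycles. -/
def cyclesInclusion (K : CochainComplex C ℤ) : zeroComplex (fun p => K.cycles p) ⟶ K :=
  ofZeroComplex K (fun p => K.iCycles p) (fun _ _ => K.iCycles_d _ _)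

/-- The projection on the cochains modulo coboundaries. -/
def opcyclesProjection (K : CochainComplex C ℤ) : K ⟶ zeroComplex (fun p => K.opcycles p) :=
  toZeroComplex K (fun p => K.pOpcycles p) (fun _ _ => K.d_pOpcycles _ _)

/-- The differential, as a morphism to the coboundaries. -/
def toBoundaries (K : CochainComplex C ℤ) :
    K ⟶ zeroComplex (fun p => image (K.d p (p + 1))) :=
  toZeroComplex K (fun p => factorThruImage (K.d p (p + 1))) (fun p q => by
    rw [← cancel_mono (image.ι _), Category.assoc, image.fac, K.d_comp_d, zero_comp])

/-- The inclusion of the coboundaries. -/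
def boundariesInclusion (K : CochainComplex C ℤ) :
    zeroComplex (fun p => image (K.d (p - 1) p)) ⟶ K :=
  ofZeroComplex K (fun p => image.ι (K.d (p - 1) p)) (fun p q => by
      rw [← cancel_epi (factorThruImage _), image.fac_assoc, K.d_comp_d, comp_zero])

section

variable (K : CochainComplex C ℤ) (a : ℤ) [K.IsStrictlyGE a]

instance : (zeroComplex fun p => K.cycles p).IsStrictlyGE a :=
  isStrictlyGE_zeroComplex fun p hp =>
    IsZero.of_mono (K.iCycles p) (K.isZero_of_isStrictlyGE a p hp)

instance : (zeroComplex fun p => K.homology p).IsStrictlyGE a :=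
  isStrictlyGE_zeroComplex fun p hp => IsZero.of_mono (K.homologyι p)
    (IsZero.of_epi (K.pOpcycles p) (K.isZero_of_isStrictlyGE a p hp))

instance : (zeroComplex fun p => K.opcycles p).IsStrictlyGE a :=
  isStrictlyGE_zeroComplex fun p hp =>
    IsZero.of_epi (K.pOpcycles p) (K.isZero_of_isStrictlyGE a p hp)

instance : (zeroComplex fun p => image (K.d p (p + 1))).IsStrictlyGE a :=
  isStrictlyGE_zeroComplex fun p hp =>
    IsZero.of_epi (factorThruImage (K.d p (p + 1))) (K.isZero_of_isStrictlyGE a p hp)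

instance : (zeroComplex fun p => image (K.d (p - 1) p)).IsStrictlyGE a :=
  isStrictlyGE_zeroComplex fun p hp =>
    IsZero.of_mono (image.ι (K.d (p - 1) p)) (K.isZero_of_isStrictlyGE a p hp)

end

/-- The sequence of cocycles, cochains and coboundaries. -/
abbrev cyclesSequence (K : CochainComplex C ℤ) : ShortComplex (CochainComplex C ℤ) :=
  ShortComplex.mk (cyclesInclusion K) (toBoundaries K) (by
    ext p
    refine (cancel_mono (image.ι (K.d p (p + 1)))).1 ?_
    exact (Category.assoc _ _ _).trans ((congrArg _ (image.fac _)).trans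
      ((K.iCycles_d _ _).trans zero_comp.symm)))

lemma cyclesSequence_shortExact (K : CochainComplex C ℤ) : (cyclesSequence K).ShortExact := by
  refine shortExact_of_degreewise_shortExact _ fun p => ?_
  let T : ShortComplex C := ShortComplex.mk (K.iCycles p) (factorThruImage (K.d p (p + 1))) (by
    rw [← cancel_mono (image.ι _), Category.assoc, image.fac, K.iCycles_d, zero_comp])
  let φ : T ⟶ ShortComplex.mk (K.iCycles p) (K.d p (p + 1)) (K.iCycles_d _ _) :=
    { τ₁ := 𝟙 _
      τ₂ := 𝟙 _
      τ₃ := image.ι _ }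
  have hT : T.Exact := by
    have : Epi φ.τ₁ := inferInstanceAs (Epi (𝟙 _))
    have : IsIso φ.τ₂ := inferInstanceAs (IsIso (𝟙 _))
    have : Mono φ.τ₃ := inferInstanceAs (Mono (image.ι _))
    rw [ShortComplex.exact_iff_of_epi_of_isIso_of_mono φ]
    exact ShortComplex.exact_of_f_is_kernel _ (K.cyclesIsKernel p (p + 1) (by simp))
  exact ShortComplex.ShortExact.mk' hT (inferInstanceAs (Mono (K.iCycles p)))
    (inferInstanceAs (Epi (factorThruImage (K.d p (p + 1)))))

/-- The sequence of coboundaries, cochains, and cochains modulo coboundaries. -/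
abbrev opcyclesSequence (K : CochainComplex C ℤ) : ShortComplex (CochainComplex C ℤ) :=
  ShortComplex.mk (boundariesInclusion K) (opcyclesProjection K) (by
    ext p
    refine (cancel_epi (factorThruImage (K.d (p - 1) p))).1 ?_
    exact (image.fac_assoc _ _).trans ((K.d_pOpcycles _ _).trans comp_zero.symm))

lemma opcyclesSequence_shortExact (K : CochainComplex C ℤ) :
    (opcyclesSequence K).ShortExact := by
  refine shortExact_of_degreewise_shortExact _ fun p => ?_
  let T : ShortComplex C := ShortComplex.mk (image.ι (K.d (p - 1) p)) (K.pOpcycles p) (by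
    rw [← cancel_epi (factorThruImage _), image.fac_assoc, K.d_pOpcycles, comp_zero])
  let φ : ShortComplex.mk (K.d (p - 1) p) (K.pOpcycles p) (K.d_pOpcycles _ _) ⟶ T :=
    { τ₁ := factorThruImage _
      τ₂ := 𝟙 _
      τ₃ := 𝟙 _ }
  have hT : T.Exact := by
    have : Epi φ.τ₁ := inferInstanceAs (Epi (factorThruImage _))
    have : IsIso φ.τ₂ := inferInstanceAs (IsIso (𝟙 _))
    have : Mono φ.τ₃ := inferInstanceAs (Mono (𝟙 _))
    rw [← ShortComplex.exact_iff_of_epi_of_isIso_of_mono φ]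
    exact ShortComplex.exact_of_g_is_cokernel _ (K.opcyclesIsCokernel (p - 1) p (by simp))
  exact ShortComplex.ShortExact.mk' hT (inferInstanceAs (Mono (image.ι (K.d (p - 1) p))))
    (inferInstanceAs (Epi (K.pOpcycles p)))

end ZeroComplex

section Kunneth

variable {C : Type*} [Category* C] [Abelian C] [MonoidalCategory C] [MonoidalPreadditive C]
  [∀ K₁ K₂ : CochainComplex C ℤ, HasTensor K₁ K₂]

lemma homologyMap_tensorRightMap_eq_zero {K K' : CochainComplex C ℤ} {f : K ⟶ K'}
    (h : Homotopy f 0) (D : CochainComplex C ℤ) (m : ℤ) :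
    homologyMap (tensorRightMap f D) m = 0 := by
  have h' : Homotopy (tensorRightMap f D) (tensorRightMap 0 D) :=
    mapBifunctorMapHomotopy₁ h (𝟙 D) (curriedTensor C) (.up ℤ)
  rw [h'.homologyMap_eq, tensorRightMap_zero, homologyMap_zero]

variable [∀ X : C, PreservesFiniteLimits (tensorRight X)]
  [∀ X : C, PreservesFiniteColimits (tensorRight X)]
  [∀ X : C, PreservesFiniteLimits (tensorLeft X)]
  [∀ X : C, PreservesFiniteColimits (tensorLeft X)]

variable (K D : CochainComplex C ℤ) (a : ℤ) [K.IsStrictlyGE a] [D.IsStrictlyGE 0] (m : ℤ)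

include a in
lemma epi_homologyMap_cyclesInclusion :
    Epi (homologyMap (tensorRightMap (cyclesInclusion K) D) m) := by
  let ι : zeroComplex (fun p => image (K.d p (p + 1))) ⟶ zeroComplex fun p => K.X (p + 1) :=
    zeroComplexMap fun p => image.ι (K.d p (p + 1))
  have hι : toBoundaries K ≫ ι = dTo K := by
    ext p
    exact image.fac (K.d p (p + 1))
  have : Mono (homologyMap (tensorRightMap ι D) m) :=
    mono_homologyMap_tensorRightMap (zeroComplex_d _) (zeroComplex_d _) ι D a m
  have h : homologyMap (tensorRightMap (toBoundaries K) D) m = 0 := by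
    rw [← cancel_mono (homologyMap (tensorRightMap ι D) m), ← homologyMap_comp,
      ← tensorRightMap_comp, hι, homologyMap_tensorRightMap_eq_zero (dToHomotopy K), zero_comp]
  exact ((shortExact_map_tensorRightFunctor (cyclesSequence_shortExact K) D
    a).homology_exact₂ m).epi_f h

include a in
lemma mono_homologyMap_opcyclesProjection :
    Mono (homologyMap (tensorRightMap (opcyclesProjection K) D) m) := by
  let π : zeroComplex (fun p => K.X (p - 1)) ⟶ zeroComplex fun p => image (K.d (p - 1) p) :=
    zeroComplexMap fun p => factorThruImage (K.d (p - 1) p)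
  have hπ : π ≫ boundariesInclusion K = dOf K := by
    ext p
    exact image.fac (K.d (p - 1) p)
  have : Epi (homologyMap (tensorRightMap π D) m) :=
    epi_homologyMap_tensorRightMap (zeroComplex_d _) (zeroComplex_d _) π D a m
  have h : homologyMap (tensorRightMap (boundariesInclusion K) D) m = 0 := by
    rw [← cancel_epi (homologyMap (tensorRightMap π D) m), ← homologyMap_comp,
      ← tensorRightMap_comp, hπ, homologyMap_tensorRightMap_eq_zero (dOfHomotopy K), comp_zero]
  exact ((shortExact_map_tensorRightFunctor (opcyclesSequence_shortExact K) D
    a).homology_exact₂ m).mono_g h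

include a in
/-- Both `Z ⊗ D ⟶ H ⊗ D ⟶ K/B ⊗ D` and `Z ⊗ D ⟶ K ⊗ D ⟶ K/B ⊗ D`, with `Z`, `B` and `H` the
cocycles, coboundaries and cohomology of `K`, induce in homology an epimorphism followed by a
monomorphism. -/
lemma nonempty_homology_tensorObj_iso_zeroComplex :
    Nonempty ((tensorObj K D).homology m ≅
      (tensorObj (zeroComplex fun p => K.homology p) D).homology m) := by
  have := epi_homologyMap_cyclesInclusion K D a m
  have := mono_homologyMap_opcyclesProjection K D a m
  let π : zeroComplex (fun p => K.cycles p) ⟶ zeroComplex fun p => K.homology p :=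
    zeroComplexMap fun p => K.homologyπ p
  let ι : (zeroComplex fun p => K.homology p) ⟶ zeroComplex fun p => K.opcycles p :=
    zeroComplexMap fun p => K.homologyι p
  have : Epi (homologyMap (tensorRightMap π D) m) :=
    epi_homologyMap_tensorRightMap (zeroComplex_d _) (zeroComplex_d _) π D a m
  have : Mono (homologyMap (tensorRightMap ι D) m) :=
    mono_homologyMap_tensorRightMap (zeroComplex_d _) (zeroComplex_d _) ι D a m
  have h : π ≫ ι = cyclesInclusion K ≫ opcyclesProjection K := by
    ext p
    exact K.homology_π_ι p
  have h' : homologyMap (tensorRightMap (cyclesInclusion K) D) m ≫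
      homologyMap (tensorRightMap (opcyclesProjection K) D) m =
        homologyMap (tensorRightMap π D) m ≫ homologyMap (tensorRightMap ι D) m := by
    rw [← homologyMap_comp, ← homologyMap_comp, ← tensorRightMap_comp, ← tensorRightMap_comp, h]
  have := strongEpi_of_epi (homologyMap (tensorRightMap π D) m)
  have := strongEpi_of_epi (homologyMap (tensorRightMap (cyclesInclusion K) D) m)
  exact ⟨image.isoStrongEpiMono _ _ h' ≪≫ (image.isoStrongEpiMono _ _ rfl).symm⟩

theorem nonempty_homology_tensorObj_iso_biproduct :
    Nonempty ((tensorObj K D).homology m ≅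
      ⨁ fun p : Finset.Icc a m => K.homology p ⊗ D.homology (m - p)) := by
  obtain ⟨e⟩ := nonempty_homology_tensorObj_iso_zeroComplex K D a m
  obtain ⟨e'⟩ := nonempty_homology_iso_biproduct_of_d_eq_zero
    (zeroComplex_d fun p => K.homology p) D a m
  exact ⟨e ≪≫ e'⟩

end Kunneth

/-! ### Locally constant sheaves -/

section TensorExact

lemma preservesFiniteColimits_of_reflective {C D E : Type*} [Category* C] [Category* D]
    [Category* E] {L : C ⥤ D} {R : D ⥤ C} (e : R ⋙ L ≅ 𝟭 D) [HasFiniteColimits C]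
    [PreservesFiniteColimits L] (G : D ⥤ E) [PreservesFiniteColimits (L ⋙ G)] :
    PreservesFiniteColimits G where
  preservesFiniteColimits J _ _ := ⟨fun {K} => by
    have : PreservesColimit ((K ⋙ R) ⋙ L) G :=
      preservesColimit_of_preserves_colimit_cocone
        (isColimitOfPreserves L (colimit.isColimit (K ⋙ R)))
        (isColimitOfPreserves (L ⋙ G) (colimit.isColimit (K ⋙ R)))
    exact preservesColimit_of_iso_diagram G
      (Functor.associator _ _ _ ≪≫ Functor.isoWhiskerLeft K e ≪≫ K.rightUnitor)⟩

section FunctorCategory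

variable {J C : Type*} [Category* J] [Category* C] [MonoidalCategory C] (P : J ⥤ C)

lemma preservesFiniteLimits_tensorLeft_functor [HasFiniteLimits C]
    [∀ A : C, PreservesFiniteLimits (tensorLeft A)] : PreservesFiniteLimits (tensorLeft P) :=
  preservesFiniteLimits_of_evaluation _ fun U =>
    inferInstanceAs (PreservesFiniteLimits ((evaluation _ C).obj U ⋙ tensorLeft (P.obj U)))

lemma preservesFiniteColimits_tensorLeft_functor [HasFiniteColimits C]
    [∀ A : C, PreservesFiniteColimits (tensorLeft A)] : PreservesFiniteColimits (tensorLeft P) :=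
  preservesFiniteColimits_of_evaluation _ fun U =>
    inferInstanceAs (PreservesFiniteColimits ((evaluation _ C).obj U ⋙ tensorLeft (P.obj U)))

end FunctorCategory

variable {k : Type u} [Field k] {X : TopCat.{u}} (F : Sh k X)

instance : BraidedCategory (Sh k X) :=
  CategoryTheory.Sheaf.braidedCategory (Opens.grothendieckTopology X) (ModuleCat.{u} k)

/-- Tensoring a sheafification with a sheaf, in terms of the tensor product of presheaves. -/
def tensorLeftIsoComp :
    sheafification k X ⋙ tensorLeft F ≅ tensorLeft F.obj ⋙ sheafification k X :=
  Functor.isoWhiskerLeft _ ((tensoringLeft (Sh k X)).mapIso ((sheafificationIso k X).app F).symm) ≪≫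
    Functor.Monoidal.commTensorLeft (sheafification k X) F.obj

instance : PreservesFiniteColimits (tensorLeft F) :=
  have := preservesFiniteColimits_tensorLeft_functor F.obj
  have : PreservesFiniteColimits (sheafification k X ⋙ tensorLeft F) :=
    preservesFiniteColimits_of_natIso (tensorLeftIsoComp F).symm
  preservesFiniteColimits_of_reflective (sheafificationIso k X) _

instance : PreservesFiniteLimits (tensorLeft F) :=
  have := preservesFiniteLimits_tensorLeft_functor F.obj
  preservesFiniteLimits_of_natIso (F := sheafToPresheaf _ _ ⋙ tensorLeft F.obj ⋙ sheafification k X)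
    (Functor.isoWhiskerLeft _ (tensorLeftIsoComp F).symm ≪≫ (Functor.associator _ _ _).symm ≪≫
      Functor.isoWhiskerRight (sheafificationIso k X) _ ≪≫ Functor.leftUnitor _)

instance : PreservesFiniteColimits (tensorRight F) :=
  preservesFiniteColimits_of_natIso (BraidedCategory.tensorLeftIsoTensorRight F)

instance : PreservesFiniteLimits (tensorRight F) :=
  preservesFiniteLimits_of_natIso (BraidedCategory.tensorLeftIsoTensorRight F)

end TensorExact

section LocalModel

open Opposite

variable {k : Type u} [Field k] {X : TopCat.{u}}

lemma presheafRes_eq_of_le {P : (Opens X)ᵒᵖ ⥤ ModuleCat.{u} k} {U V W W' : Opens X} {hU : W ≤ U}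
    {hV : W ≤ V} {s : P.obj (op U)} {t : P.obj (op V)} (h : W' ≤ W)
    (hst : presheafRes P hU s = presheafRes P hV t) :
    presheafRes P (h.trans hU) s = presheafRes P (h.trans hV) t := by
  rw [← presheafRes_presheafRes P hU h, hst, presheafRes_presheafRes]

/-- The linear map `α` identifies the restriction to `U` of the sheaf associated with `P` with the
constant sheaf of stalk `V`. -/
structure IsLocalModel (P : (Opens X)ᵒᵖ ⥤ ModuleCat.{u} k) (U : Opens X) {V : Type*}
    [AddCommGroup V] [Module k V] (α : V →ₗ[k] P.obj (op U)) : Prop where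
  eq_zero : ∀ {W : Opens X} (h : W ≤ U) {x : X}, x ∈ W → ∀ v, presheafRes P h (α v) = 0 → v = 0
  exists_res_eq : ∀ {W : Opens X} (h : W ≤ U) {x : X}, x ∈ W → ∀ s : P.obj (op W),
    ∃ (W' : Opens X) (h' : W' ≤ W), x ∈ W' ∧
      ∃ v, presheafRes P (h'.trans h) (α v) = presheafRes P h' s

namespace IsLocalModel

variable {P Q : (Opens X)ᵒᵖ ⥤ ModuleCat.{u} k} {U : Opens X}
  {V V' : Type*} [AddCommGroup V] [Module k V] [AddCommGroup V'] [Module k V']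

lemma const (V : ModuleCat.{u} k) (U : Opens X) :
    IsLocalModel ((Functor.const (Opens X)ᵒᵖ).obj V) U LinearMap.id where
  eq_zero _ _ _ _ hv := hv
  exists_res_eq {W} _ _ hx s := ⟨W, le_rfl, hx, s, rfl⟩

lemma injective {α : V →ₗ[k] P.obj (op U)} (hα : IsLocalModel P U α) {W : Opens X} (h : W ≤ U)
    {x : X} (hx : x ∈ W) : Function.Injective (presheafRes P h ∘ₗ α) :=
  (injective_iff_map_eq_zero _).2 fun v hv => hα.eq_zero h hx v hv

lemma restrict {α : V →ₗ[k] P.obj (op U)} (hα : IsLocalModel P U α) {U' : Opens X} (hU : U' ≤ U) :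
    IsLocalModel P U' (presheafRes P hU ∘ₗ α) where
  eq_zero h _ hx v hv := by
    rw [LinearMap.comp_apply, presheafRes_presheafRes] at hv
    exact hα.eq_zero _ hx v hv
  exists_res_eq h _ hx s := by
    obtain ⟨W', h', hxW', v, hv⟩ := hα.exists_res_eq (h.trans hU) hx s
    exact ⟨W', h', hxW', v, by rw [LinearMap.comp_apply, presheafRes_presheafRes, hv]⟩

lemma map {α : V →ₗ[k] P.obj (op U)} (hα : IsLocalModel P U α) (η : P ⟶ Q)
    [Presheaf.IsLocallyInjective (Opens.grothendieckTopology X) η]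
    [Presheaf.IsLocallySurjective (Opens.grothendieckTopology X) η] :
    IsLocalModel Q U ((η.app (op U)).hom ∘ₗ α) where
  eq_zero {W} h x hx v hv := by
    rw [LinearMap.comp_apply, ← app_presheafRes] at hv
    obtain ⟨W', i, hW', hxW'⟩ := Presheaf.equalizerSieve_mem (Opens.grothendieckTopology X)
      η (X := op W) _ _ (hv.trans (map_zero _).symm) x hx
    refine hα.eq_zero ((leOfHom i).trans h) hxW' v ?_
    rw [← presheafRes_presheafRes P h (leOfHom i)]
    exact hW'.trans (map_zero (P.map i.op).hom)
  exists_res_eq {W} h x hx s := by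
    obtain ⟨W', i, ⟨t, ht⟩, hxW'⟩ :=
      Presheaf.imageSieve_mem (Opens.grothendieckTopology X) η s x hx
    obtain ⟨W'', h', hxW'', v, hv⟩ := hα.exists_res_eq ((leOfHom i).trans h) hxW' t
    refine ⟨W'', h'.trans (leOfHom i), hxW'', v, ?_⟩
    rw [LinearMap.comp_apply, ← app_presheafRes, hv, app_presheafRes]
    exact (congrArg (presheafRes Q h') ht).trans (presheafRes_presheafRes Q (leOfHom i) h' s)

/-- The tensor product of two linear maps to sections of presheaves. -/
def tensorSec (α : V →ₗ[k] P.obj (op U)) (β : V' →ₗ[k] Q.obj (op U)) :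
    TensorProduct k V V' →ₗ[k] (P ⊗ Q).obj (op U) :=
  TensorProduct.map α β

lemma tensor {α : V →ₗ[k] P.obj (op U)} {β : V' →ₗ[k] Q.obj (op U)} (hα : IsLocalModel P U α)
    (hβ : IsLocalModel Q U β) : IsLocalModel (P ⊗ Q) U (tensorSec α β) where
  eq_zero h _ hx t ht := by
    refine TensorProduct.map_injective_of_flat_flat _ _ (hα.injective h hx) (hβ.injective h hx) ?_
    rw [TensorProduct.map_comp, map_zero]
    exact ht
  exists_res_eq {W} h x hx s := by
    refine TensorProduct.induction_on (M := P.obj (op W)) (N := Q.obj (op W)) s ?_ ?_ ?_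
    · refine ⟨W, le_rfl, hx, 0, ?_⟩
      rw [map_zero, map_zero]
      exact (map_zero _).symm
    · intro s t
      obtain ⟨W₁, h₁, hx₁, v₁, hv₁⟩ := hα.exists_res_eq h hx s
      obtain ⟨W₂, h₂, hx₂, v₂, hv₂⟩ := hβ.exists_res_eq h hx t
      refine ⟨W₁ ⊓ W₂, inf_le_left.trans h₁, ⟨hx₁, hx₂⟩, TensorProduct.tmul k v₁ v₂, ?_⟩
      exact congrArg₂ (TensorProduct.tmul k) (presheafRes_eq_of_le inf_le_left hv₁)
        (presheafRes_eq_of_le inf_le_right hv₂)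
    · rintro s t ⟨W₁, h₁, hx₁, v₁, hv₁⟩ ⟨W₂, h₂, hx₂, v₂, hv₂⟩
      refine ⟨W₁ ⊓ W₂, inf_le_left.trans h₁, ⟨hx₁, hx₂⟩, v₁ + v₂, ?_⟩
      rw [map_add, map_add, presheafRes_eq_of_le inf_le_left hv₁,
        presheafRes_eq_of_le inf_le_right hv₂]
      exact (map_add _ _ _).symm

lemma pi {ι : Type*} [Finite ι] {Q : ι → (Opens X)ᵒᵖ ⥤ ModuleCat.{u} k} {V : ι → Type*}
    [∀ i, AddCommGroup (V i)] [∀ i, Module k (V i)] {β : ∀ i, V i →ₗ[k] (Q i).obj (op U)}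
    (hβ : ∀ i, IsLocalModel (Q i) U (β i)) {α : (∀ i, V i) →ₗ[k] P.obj (op U)} (π : ∀ i, P ⟶ Q i)
    (hα : ∀ i v, ((π i).app (op U)).hom (α v) = β i (v i))
    (hπ : ∀ (W : Opens X) (s t : P.obj (op W)),
      (∀ i, ((π i).app (op W)).hom s = ((π i).app (op W)).hom t) → s = t) :
    IsLocalModel P U α where
  eq_zero h _ hx v hv := by
    funext i
    refine (hβ i).eq_zero h hx _ ?_
    rw [← hα, ← app_presheafRes, hv, map_zero]
  exists_res_eq {W} h x hx s := by
    choose W' h' hx' v hv using fun i => (hβ i).exists_res_eq h hx (((π i).app (op W)).hom s)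
    refine ⟨W ⊓ ⨅ i, W' i, inf_le_left, ⟨hx, ?_⟩, v, hπ _ _ _ fun i => ?_⟩
    · rw [SetLike.mem_coe, ← SetLike.mem_coe, Opens.coe_iInf]
      exact Set.mem_iInter.2 hx'
    · rw [app_presheafRes, app_presheafRes, hα]
      exact presheafRes_eq_of_le (inf_le_right.trans (iInf_le W' i)) (hv i)

end IsLocalModel

lemma isLocalModel_comp_functor_iff {Y : TopCat.{u}} {f : Y ⟶ X} (hf : Topology.IsOpenEmbedding f)
    (P : (Opens X)ᵒᵖ ⥤ ModuleCat.{u} k) (U : Opens Y) {V : Type*} [AddCommGroup V] [Module k V]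
    (α : V →ₗ[k] P.obj (op (hf.functor.obj U))) :
    IsLocalModel (hf.functor.op ⋙ P) U α ↔ IsLocalModel P (hf.functor.obj U) α := by
  have hle (W : Opens X) : hf.functor.obj ((Opens.map f).obj W) ≤ W := Set.image_preimage_subset _ _
  have hpre {W : Opens X} {U : Opens Y} (h : W ≤ hf.functor.obj U) : (Opens.map f).obj W ≤ U :=
    ((Opens.map f).monotone h).trans (Opens.map_functor_eq' f hf U).le
  have himg {W W' : Opens Y} (h : W ≤ W') : hf.functor.obj W ≤ hf.functor.obj W' := Set.image_mono h
  constructor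
  · intro hα
    constructor
    · intro W h x hx v hv
      obtain ⟨y, -, rfl⟩ := h hx
      refine hα.eq_zero (hpre h) hx v ?_
      exact (presheafRes_presheafRes P h (hle W) (α v)).symm.trans
        ((congrArg (presheafRes P (hle W)) hv).trans (map_zero _))
    · intro W h x hx s
      obtain ⟨y, -, rfl⟩ := h hx
      obtain ⟨W', h', hyW', v, hv⟩ := hα.exists_res_eq (hpre h) hx (presheafRes P (hle W) s)
      exact ⟨hf.functor.obj W', (himg h').trans (hle W), ⟨y, hyW', rfl⟩, v,
        hv.trans (presheafRes_presheafRes P (hle W) (himg h') s)⟩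
  · intro hα
    constructor
    · intro W h y hy v hv
      exact hα.eq_zero (himg h) (x := f y) ⟨y, hy, rfl⟩ v hv
    · intro W h y hy s
      obtain ⟨W', h', hyW', v, hv⟩ := hα.exists_res_eq (himg h) (x := f y) ⟨y, hy, rfl⟩ s
      exact ⟨(Opens.map f).obj W', hpre h', hyW', v, presheafRes_eq_of_le (hle W') hv⟩

/-- The morphism from a constant presheaf given by a linear map to the global sections. -/
def constPresheafDesc {P : (Opens X)ᵒᵖ ⥤ ModuleCat.{u} k} {V : ModuleCat.{u} k}
    (α : V →ₗ[k] P.obj (op ⊤)) : (Functor.const (Opens X)ᵒᵖ).obj V ⟶ P where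
  app U := ModuleCat.ofHom (presheafRes P (le_top : U.unop ≤ ⊤) ∘ₗ α)
  naturality U W i := by
    ext v
    exact (presheafRes_presheafRes P le_top (leOfHom i.unop) (α v)).symm

namespace IsLocalModel

variable {P : (Opens X)ᵒᵖ ⥤ ModuleCat.{u} k} {V : ModuleCat.{u} k} {α : V →ₗ[k] P.obj (op ⊤)}

lemma isLocallyInjective_constPresheafDesc (hα : IsLocalModel P ⊤ α) :
    Presheaf.IsLocallyInjective (Opens.grothendieckTopology X) (constPresheafDesc α) where
  equalizerSieve_mem {W} _ _ h _ hx := by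
    obtain rfl := hα.injective le_top hx h
    exact ⟨W.unop, 𝟙 _, rfl, hx⟩

lemma isLocallySurjective_constPresheafDesc (hα : IsLocalModel P ⊤ α) :
    Presheaf.IsLocallySurjective (Opens.grothendieckTopology X) (constPresheafDesc α) where
  imageSieve_mem s _ hx := by
    obtain ⟨W', h', hxW', v, hv⟩ := hα.exists_res_eq le_top hx s
    exact ⟨W', homOfLE h', ⟨v, hv⟩, hxW'⟩

end IsLocalModel

lemma isLocalModel_constSec (V : ModuleCat.{u} k) (U : Opens X) :
    IsLocalModel (constSheafOf X V).obj U (constSec X V U) :=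
  (IsLocalModel.const V U).map (toSheafify _ _)

lemma IsLocalModel.of_iso {F G : Sh k X} {U : Opens X} {V : Type*} [AddCommGroup V] [Module k V]
    {α : V →ₗ[k] sec F U} (hα : IsLocalModel F.obj U α) (e : F ≅ G) :
    IsLocalModel G.obj U (secMap e.hom U ∘ₗ α) :=
  hα.map ((sheafToPresheaf _ _).mapIso e).hom

lemma isConstant_iff_exists_isLocalModel (F : Sh k X) :
    Sheaf.IsConstant (Opens.grothendieckTopology X) F ↔
      ∃ (V : ModuleCat.{u} k) (α : V →ₗ[k] F.obj.obj (op ⊤)), IsLocalModel F.obj ⊤ α := by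
  constructor
  · rintro ⟨V, ⟨e⟩⟩
    exact ⟨V, _, (isLocalModel_constSec V ⊤).of_iso e⟩
  · rintro ⟨V, α, hα⟩
    have := hα.isLocallyInjective_constPresheafDesc
    have := hα.isLocallySurjective_constPresheafDesc
    have : IsIso ((sheafification k X).map (constPresheafDesc α)) :=
      (GrothendieckTopology.W_iff _ _).1 (GrothendieckTopology.W_of_isLocallyBijective _ _)
    exact Sheaf.isConstant_of_iso _ (((sheafificationIso k X).app F).symm ≪≫
      (asIso ((sheafification k X).map (constPresheafDesc α))).symm)

theorem isLocallyConstantSheaf_iff (F : Sh k X) :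
    IsLocallyConstantSheaf F ↔ ∀ x : X, ∃ U : Opens X, x ∈ U ∧
      ∃ (V : ModuleCat.{u} k) (α : V →ₗ[k] F.obj.obj (op U)), IsLocalModel F.obj U α := by
  refine forall_congr' fun x => exists_congr fun U => and_congr_right fun _ => ?_
  have hconst := isConstant_iff_exists_isLocalModel (X := TopCat.of U) (U.sheafRestrict.obj F)
  refine hconst.trans ((exists₂_congr fun V α =>
    isLocalModel_comp_functor_iff U.isOpenEmbedding F.obj ⊤ α).trans ?_)
  rw [Opens.isOpenEmbedding_obj_top]

lemma IsLocallyConstantSheaf.of_iso {F G : Sh k X} (hF : IsLocallyConstantSheaf F) (e : F ≅ G) :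
    IsLocallyConstantSheaf G := by
  rw [isLocallyConstantSheaf_iff] at hF ⊢
  intro x
  obtain ⟨U, hx, V, α, hα⟩ := hF x
  exact ⟨U, hx, V, _, hα.of_iso e⟩

lemma isLocallyConstantSheaf_constSheafOf (V : ModuleCat.{u} k) :
    IsLocallyConstantSheaf (constSheafOf X V) :=
  (isLocallyConstantSheaf_iff _).2 fun _ => ⟨⊤, trivial, V, _, isLocalModel_constSec V ⊤⟩

lemma isLocallyConstantSheaf_of_isZero {F : Sh k X} (hF : IsZero F) :
    IsLocallyConstantSheaf F :=
  (isLocallyConstantSheaf_constSheafOf (ModuleCat.of k PUnit)).of_iso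
    ((Functor.map_isZero _ (ModuleCat.isZero_of_subsingleton _)).iso hF)

lemma secMap_sum {ι : Type*} (s : Finset ι) {F G : Sh k X} (f : ι → (F ⟶ G)) (U : Opens X)
    (t : sec F U) : secMap (∑ i ∈ s, f i) U t = ∑ i ∈ s, secMap (f i) U t := by
  classical
  induction s using Finset.induction_on with
  | empty => rfl
  | insert i s hi ih =>
    rw [Finset.sum_insert hi, Finset.sum_insert hi, ← ih]
    rfl

lemma sec_biproduct_ext {ι : Type} [Finite ι] (F : ι → Sh k X) [HasBiproduct F] (U : Opens X)
    (s t : sec (⨁ F) U)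
    (h : ∀ i, secMap (biproduct.π F i) U s = secMap (biproduct.π F i) U t) : s = t := by
  have := Fintype.ofFinite ι
  have hsum (s : sec (⨁ F) U) :
      s = ∑ i, secMap (biproduct.ι F i) U (secMap (biproduct.π F i) U s) :=
    congr(secMap $(biproduct.total.symm) U s).trans (secMap_sum _ _ U s)
  rw [hsum s, hsum t]
  exact Finset.sum_congr rfl fun i _ => by rw [h]

lemma isLocallyConstantSheaf_biproduct {ι : Type} [Finite ι] {F : ι → Sh k X} [HasBiproduct F]
    (hF : ∀ i, IsLocallyConstantSheaf (F i)) : IsLocallyConstantSheaf (⨁ F) := by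
  classical
  have := Fintype.ofFinite ι
  simp only [isLocallyConstantSheaf_iff] at hF ⊢
  intro x
  choose U hxU V β hβ using fun i => hF i x
  let U' := ⨅ i, U i
  have hU' : x ∈ U' := by
    rw [← SetLike.mem_coe, Opens.coe_iInf]
    exact Set.mem_iInter.2 hxU
  let β' i : V i →ₗ[k] sec (F i) U' := presheafRes (F i).obj (iInf_le U i) ∘ₗ β i
  let α : (∀ i, V i) →ₗ[k] sec (⨁ F) U' :=
    ∑ i, secMap (biproduct.ι F i) U' ∘ₗ β' i ∘ₗ LinearMap.proj i
  have hα i v : secMap (biproduct.π F i) U' (α v) = β' i (v i) := by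
    simp only [α, LinearMap.sum_apply, LinearMap.comp_apply, LinearMap.proj_apply, map_sum]
    rw [Finset.sum_eq_single i]
    · rw [← secMap_comp, biproduct.ι_π_self]
      rfl
    · intro j _ hji
      rw [← secMap_comp, biproduct.ι_π_ne F hji, secMap_zero]
    · exact fun hi => absurd (Finset.mem_univ i) hi
  exact ⟨U', hU', ModuleCat.of k (∀ i, V i), α,
    IsLocalModel.pi (fun i => (hβ i).restrict (iInf_le U i)) (fun i => (biproduct.π F i).hom) hα
      (sec_biproduct_ext F)⟩

/-- The tensor product of sheaves is the sheafification of the tensor product of presheaves. -/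
def tensorIsoSheafification (F G : Sh k X) :
    F ⊗ G ≅ (sheafification k X).obj (F.obj ⊗ G.obj) :=
  (((sheafificationIso k X).app F).symm ⊗ᵢ ((sheafificationIso k X).app G).symm) ≪≫
    Functor.Monoidal.μIso (sheafification k X) F.obj G.obj

lemma IsLocallyConstantSheaf.tensor {F G : Sh k X} (hF : IsLocallyConstantSheaf F)
    (hG : IsLocallyConstantSheaf G) : IsLocallyConstantSheaf (F ⊗ G) := by
  suffices IsLocallyConstantSheaf ((sheafification k X).obj (F.obj ⊗ G.obj)) from
    this.of_iso (tensorIsoSheafification F G).symm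
  rw [isLocallyConstantSheaf_iff] at hF hG ⊢
  intro x
  obtain ⟨U₁, hx₁, V₁, α₁, hα₁⟩ := hF x
  obtain ⟨U₂, hx₂, V₂, α₂, hα₂⟩ := hG x
  exact ⟨U₁ ⊓ U₂, ⟨hx₁, hx₂⟩, ModuleCat.of k (TensorProduct k V₁ V₂), _,
    ((hα₁.restrict inf_le_left).tensor (hα₂.restrict inf_le_right)).map (toSheafify _ _)⟩

end LocalModel

/-! ### Iterated cones -/

section Triangulated

variable {T : Type*} [Category* T] [HasZeroObject T] [HasShift T ℤ] [Preadditive T]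
  [∀ n : ℤ, (shiftFunctor T n).Additive] [Pretriangulated T]

lemma isDirectSummand_of_distinguished_zero {A B C : T} {f : A ⟶ B} {g : B ⟶ C}
    {h : C ⟶ A⟦(1 : ℤ)⟧} (hT : Triangle.mk f g h ∈ distTriang T) (hf : f = 0) :
    IsDirectSummand B C := by
  obtain ⟨e, -⟩ := exists_iso_binaryBiproduct_of_distTriang _ (rot_of_distTriang _ hT) (by
    change -f⟦(1 : ℤ)⟧' = 0
    rw [hf, Functor.map_zero, neg_zero])
  exact ⟨_, ⟨e⟩⟩

lemma distinguished_of_iso₁₂ {A A' B B' C : T} {f : A ⟶ B} {g : B ⟶ C} {h : C ⟶ A⟦(1 : ℤ)⟧}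
    (hT : Triangle.mk f g h ∈ distTriang T) (e : A' ≅ A) (e' : B' ≅ B) :
    Triangle.mk (e.hom ≫ f ≫ e'.inv) (e'.hom ≫ g) (h ≫ e.inv⟦(1 : ℤ)⟧') ∈ distTriang T := by
  refine isomorphic_distinguished _ hT _ (Triangle.isoMk _ _ e e' (Iso.refl _) ?_ ?_ ?_)
  · change (e.hom ≫ f ≫ e'.inv) ≫ e'.hom = e.hom ≫ f
    simp
  · exact Category.comp_id _
  · change (h ≫ e.inv⟦(1 : ℤ)⟧') ≫ e.hom⟦(1 : ℤ)⟧' = 𝟙 C ≫ h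
    rw [Category.assoc, ← Functor.map_comp, e.inv_hom_id, CategoryTheory.Functor.map_id,
      Category.comp_id, Category.id_comp]

lemma exists_distinguished_shift {A B C : T} {f : A ⟶ B} {g : B ⟶ C} {h : C ⟶ A⟦(1 : ℤ)⟧}
    (hT : Triangle.mk f g h ∈ distTriang T) {a b : ℤ} (hab : a + -1 = b) :
    ∃ (u : C⟦b⟧ ⟶ A⟦a⟧) (v : A⟦a⟧ ⟶ B⟦a⟧) (w : B⟦a⟧ ⟶ C⟦b⟧⟦(1 : ℤ)⟧),
      Triangle.mk u v w ∈ distTriang T :=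
  ⟨_, _, _, distinguished_of_iso₁₂
    (inv_rot_of_distTriang _ (Triangle.shift_distinguished _ hT a))
    ((shiftFunctorAdd' T a (-1) b hab).app C) (Iso.refl _)⟩

variable {𝓕 : ObjectProperty T}

lemma FiniteSumsOfShifts.of_mem {F : T} (hF : 𝓕 F) : FiniteSumsOfShifts 𝓕 F :=
  ⟨1, fun _ => F, fun _ => 0, fun _ => hF,
    ⟨((shiftFunctorZero T ℤ).app F).symm ≪≫ (biproductUniqueIso fun _ : Fin 1 => F⟦(0 : ℤ)⟧).symm⟩⟩

lemma FiniteSumsOfShifts.shift {F : T} (hF : FiniteSumsOfShifts 𝓕 F) (a : ℤ) :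
    FiniteSumsOfShifts 𝓕 (F⟦a⟧) := by
  obtain ⟨m, E, d, hE, ⟨i⟩⟩ := hF
  exact ⟨m, E, fun j => d j + a, hE, ⟨(shiftFunctor T a).mapIso i ≪≫
    (shiftFunctor T a).mapBiproduct _ ≪≫
      biproduct.mapIso fun j => ((shiftFunctorAdd T (d j) a).app (E j)).symm⟩⟩

lemma IteratedCones.shift (a : ℤ) : ∀ (j : ℕ) {F : T}, IteratedCones 𝓕 j F →
    IteratedCones 𝓕 j (F⟦a⟧)
  | 0, _, hF => FiniteSumsOfShifts.shift hF a
  | j + 1, _, ⟨_, _, _, _, _, h₁, h₀, hT⟩ =>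
    ⟨_, _, _, _, _, IteratedCones.shift a j h₁, h₀.shift a, Triangle.shift_distinguished _ hT a⟩

/- The triangles splice to morphisms `P (j + 1)[-j-1] → P j[-j] → ⋯ → P 0`, and the octahedral axiom
compares the cones of two consecutive composites. -/
lemma exists_iteratedCones_of_distinguished [IsTriangulated T] {P E : ℕ → T} (hE : ∀ j, 𝓕 (E j))
    {f : ∀ j, P j ⟶ E j} {g : ∀ j, E j ⟶ P (j + 1)} {h : ∀ j, P (j + 1) ⟶ (P j)⟦(1 : ℤ)⟧}
    (hT : ∀ j, Triangle.mk (f j) (g j) (h j) ∈ distTriang T) (j : ℕ) :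
    ∃ (C : T) (u : (P (j + 1))⟦-((j + 1 : ℕ) : ℤ)⟧ ⟶ P 0) (v : P 0 ⟶ C)
      (w : C ⟶ (P (j + 1))⟦-((j + 1 : ℕ) : ℤ)⟧⟦(1 : ℤ)⟧),
      Triangle.mk u v w ∈ distTriang T ∧ IteratedCones 𝓕 j C := by
  have mem_shift (i : ℕ) (a : ℤ) : FiniteSumsOfShifts 𝓕 ((E i)⟦a⟧) :=
    (FiniteSumsOfShifts.of_mem (hE i)).shift a
  choose u v w huvw using fun i : ℕ => exists_distinguished_shift (hT i)
    (show -(i : ℤ) + -1 = -((i + 1 : ℕ) : ℤ) by push_cast; ring)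
  induction j with
  | zero =>
    let e : (P 0)⟦-((0 : ℕ) : ℤ)⟧ ≅ P 0 := (shiftFunctorZero' T _ (by simp)).app _
    exact ⟨_, _, _, _, distinguished_of_iso₁₂ (huvw 0) (Iso.refl _) e.symm, mem_shift 0 _⟩
  | succ j ih =>
    obtain ⟨C, u', _, _, hC, hmem⟩ := ih
    obtain ⟨C', _, _, hC'⟩ := distinguished_cocone_triangle (u (j + 1) ≫ u')
    have octahedron := Triangulated.someOctahedron rfl (huvw (j + 1)) hC hC'
    exact ⟨C', _, _, _, hC', _, _, _, _, _, IteratedCones.shift (-1) j hmem, mem_shift (j + 1) _,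
      inv_rot_of_distTriang _ octahedron.mem⟩

end Triangulated

section Truncation

variable {C : Type*} [Category* C] [Abelian C]

lemma isStrictlyGE_of_shortExact {S : ShortComplex (CochainComplex C ℤ)} (hS : S.ShortExact)
    (a : ℤ) [S.X₂.IsStrictlyGE a] : S.X₁.IsStrictlyGE a ∧ S.X₃.IsStrictlyGE a := by
  simp only [CochainComplex.isStrictlyGE_iff]
  refine ⟨fun i hi => ?_, fun i hi => ?_⟩
  · have := (hS.map_of_exact (eval C _ i)).mono_f
    exact @IsZero.of_mono _ _ _ _ _ (S.map (eval C _ i)).f this (S.X₂.isZero_of_isStrictlyGE a i hi)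
  · have := (hS.map_of_exact (eval C _ i)).epi_g
    exact @IsZero.of_epi _ _ _ _ _ (S.map (eval C _ i)).g this (S.X₂.isZero_of_isStrictlyGE a i hi)

variable (K : CochainComplex C ℤ)

lemma isStrictlyGE_shortComplexTruncLE (n a : ℤ) [K.IsStrictlyGE a] :
    (K.shortComplexTruncLE n).X₁.IsStrictlyGE a ∧ (K.shortComplexTruncLE n).X₃.IsStrictlyGE a :=
  have : (K.shortComplexTruncLE n).X₂.IsStrictlyGE a := inferInstanceAs (K.IsStrictlyGE a)
  isStrictlyGE_of_shortExact (K.shortComplexTruncLE_shortExact n) a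

lemma nonempty_truncLE_iso_single (n : ℤ) [K.IsStrictlyGE n] :
    Nonempty (K.truncLE n ≅ (single C (.up ℤ) n).obj (K.homology n)) := by
  have : (K.truncLE n).IsStrictlyGE n := (isStrictlyGE_shortComplexTruncLE K n n).1
  obtain ⟨M, ⟨e⟩⟩ := (K.truncLE n).exists_iso_single n
  let i : M ≅ K.homology n := (singleObjHomologySelfIso (.up ℤ) n M).symm ≪≫
    ((homologyFunctor C (.up ℤ) n).mapIso e).symm ≪≫ isoOfQuasiIsoAt (K.ιTruncLE n) n
  exact ⟨e ≪≫ (single C _ n).mapIso i⟩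

lemma isZero_homology_shortComplexTruncLE_X₃ {n i : ℤ} (hi : i < n + 1) :
    IsZero ((K.shortComplexTruncLE n).X₃.homology i) :=
  IsZero.of_iso ((K.truncGE (n + 1)).isZero_of_isGE (n + 1) i hi)
    (isoOfQuasiIsoAt (K.shortComplexTruncLEX₃ToTruncGE n (n + 1) rfl) i)

lemma nonempty_homology_shortComplexTruncLE_X₃_iso {n i : ℤ} (hi : n + 1 ≤ i) :
    Nonempty ((K.shortComplexTruncLE n).X₃.homology i ≅ K.homology i) :=
  have := K.quasiIsoAt_πTruncGE (n + 1) i hi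
  ⟨isoOfQuasiIsoAt (K.shortComplexTruncLEX₃ToTruncGE n (n + 1) rfl) i ≪≫
    (isoOfQuasiIsoAt (K.πTruncGE (n + 1)) i).symm⟩

variable [MonoidalCategory C] [MonoidalPreadditive C]
  [∀ K₁ K₂ : CochainComplex C ℤ, HasTensor K₁ K₂]
  [∀ X : C, PreservesFiniteLimits (tensorRight X)]
  [∀ X : C, PreservesFiniteColimits (tensorRight X)]
  [∀ X : C, PreservesFiniteLimits (tensorLeft X)]
  [∀ X : C, PreservesFiniteColimits (tensorLeft X)]

lemma isZero_homology_tensorObj (D : CochainComplex C ℤ) (c : ℤ) [K.IsStrictlyGE c]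
    [D.IsStrictlyGE 0] {a b m : ℤ} (hK : ∀ p < a, IsZero (K.homology p))
    (hD : ∀ q < b, IsZero (D.homology q)) (hm : m < a + b) :
    IsZero ((tensorObj K D).homology m) := by
  obtain ⟨e⟩ := nonempty_homology_tensorObj_iso_biproduct K D c m
  refine IsZero.of_iso ((IsZero.iff_id_eq_zero _).2 (biproduct.hom_ext' _ _ fun p => ?_)) e
  refine IsZero.eq_of_src ?_ _ _
  by_cases hp : (p : ℤ) < a
  · exact isZero_tensor_left (hK _ hp) _
  · exact isZero_tensor_right _ (hD _ (by lia))

end Truncation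

section TensorPower

variable {k : Type u} [Field k] {X : TopCat.{u}}

variable (k X) in
/-- The unit for the tensor product of sheaves is the constant sheaf. -/
def tensorUnitIsoConstSheaf : 𝟙_ (Sh k X) ≅ constSheaf k X :=
  Functor.Monoidal.εIso (sheafification k X)

lemma nonempty_tensorObj_single_constSheaf_iso (D : CochainComplex (Sh k X) ℤ) :
    Nonempty (tensorObj ((single (Sh k X) (.up ℤ) 0).obj (constSheaf k X)) D ≅ D) := by
  have (F : Sh k X) : PreservesColimit (Functor.empty.{0} (Sh k X))
      ((curriedTensor (Sh k X)).flip.obj F) :=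
    inferInstanceAs (PreservesColimit (Functor.empty.{0} (Sh k X)) (tensorRight F))
  exact ⟨(tensorRightFunctor D).mapIso
    ((single _ _ 0).mapIso (tensorUnitIsoConstSheaf k X).symm) ≪≫ leftUnitor D⟩

lemma isLocallyConstantSheaf_homology_tensorObj (K D : CochainComplex (Sh k X) ℤ) (a : ℤ)
    [K.IsStrictlyGE a] [D.IsStrictlyGE 0] (hK : ∀ p, IsLocallyConstantSheaf (K.homology p))
    (hD : ∀ q, IsLocallyConstantSheaf (D.homology q)) (m : ℤ) :
    IsLocallyConstantSheaf ((tensorObj K D).homology m) := by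
  obtain ⟨e⟩ := nonempty_homology_tensorObj_iso_biproduct K D a m
  have (p : Finset.Icc a m) : IsLocallyConstantSheaf (K.homology p ⊗ D.homology (m - p)) :=
    (hK p).tensor (hD _)
  exact (isLocallyConstantSheaf_biproduct this).of_iso e.symm

lemma isLocallyConstantSheaf_homology_shortComplexTruncLE_X₃ {K : CochainComplex (Sh k X) ℤ}
    (hK : ∀ p, IsLocallyConstantSheaf (K.homology p)) (n p : ℤ) :
    IsLocallyConstantSheaf ((K.shortComplexTruncLE n).X₃.homology p) := by
  by_cases hp : p < n + 1
  · exact isLocallyConstantSheaf_of_isZero (isZero_homology_shortComplexTruncLE_X₃ K hp)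
  · obtain ⟨i⟩ := nonempty_homology_shortComplexTruncLE_X₃_iso K (not_lt.1 hp)
    exact (hK p).of_iso i.symm

/-- The iterated tensor product `C ⊗ (C ⊗ ⋯ (C ⊗ k_X))`. -/
def tensorPower (C : CochainComplex (Sh k X) ℤ) : ℕ → CochainComplex (Sh k X) ℤ
  | 0 => (single (Sh k X) (.up ℤ) 0).obj (constSheaf k X)
  | j + 1 => tensorObj C (tensorPower C j)

variable (C : CochainComplex (Sh k X) ℤ) [C.IsStrictlyGE 0]

instance isStrictlyGE_tensorPower : ∀ j, (tensorPower C j).IsStrictlyGE 0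
  | 0 => inferInstanceAs (CochainComplex.IsStrictlyGE
      ((single (Sh k X) (.up ℤ) 0).obj (constSheaf k X)) 0)
  | j + 1 =>
    have := isStrictlyGE_tensorPower j
    isStrictlyGE_tensorObj C (tensorPower C j) 0 0 rfl

variable {C}

lemma isLocallyConstantSheaf_homology_tensorPower
    (hC : ∀ p, IsLocallyConstantSheaf (C.homology p)) :
    ∀ (j : ℕ) (m : ℤ), IsLocallyConstantSheaf ((tensorPower C j).homology m)
  | 0, m => by
    by_cases hm : m = 0
    · subst hm
      exact (isLocallyConstantSheaf_constSheafOf (ModuleCat.of k k)).of_iso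
        (singleObjHomologySelfIso (.up ℤ) 0 (constSheaf k X)).symm
    · exact isLocallyConstantSheaf_of_isZero (isZero_single_obj_homology _ _ _ _ hm)
  | j + 1, m => isLocallyConstantSheaf_homology_tensorObj C _ 0 hC
      (isLocallyConstantSheaf_homology_tensorPower hC j) m

lemma isZero_homology_tensorPower (hC : ∀ p < 1, IsZero (C.homology p)) :
    ∀ (j : ℕ) (m : ℤ), m < j → IsZero ((tensorPower C j).homology m)
  | 0, m, hm => isZero_single_obj_homology _ _ _ _ (by simpa using hm.ne)
  | j + 1, m, hm => isZero_homology_tensorObj C _ 0 hC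
      (isZero_homology_tensorPower hC j) (by push_cast at hm; lia)

end TensorPower

section Derived

/-- The homology of an object of the derived category, computed on a representing complex. -/
def homologyIsoOfIsoQ {A : Type*} [Category* A] [Abelian A] [HasDerivedCategory.{w} A]
    {L : DerivedCategory A} {K : CochainComplex A ℤ} (e : L ≅ DerivedCategory.Q.obj K) (i : ℤ) :
    (DerivedCategory.homologyFunctor A i).obj L ≅ K.homology i :=
  (DerivedCategory.homologyFunctor A i).mapIso e ≪≫
    (DerivedCategory.homologyFunctorFactors A i).app K

variable {k : Type u} [Field k] {X : TopCat.{u}} [HasDerivedCategory.{w} (Sh k X)]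

lemma exists_distinguished_tensorObj (K : CochainComplex (Sh k X) ℤ) [K.IsStrictlyGE 0]
    (e : K.homology 0 ≅ constSheaf k X) (D : CochainComplex (Sh k X) ℤ) [D.IsStrictlyGE 0] :
    ∃ (f : DerivedCategory.Q.obj D ⟶ DerivedCategory.Q.obj (tensorObj K D))
      (g : DerivedCategory.Q.obj (tensorObj K D) ⟶
        DerivedCategory.Q.obj (tensorObj (K.shortComplexTruncLE 0).X₃ D))
      (h : DerivedCategory.Q.obj (tensorObj (K.shortComplexTruncLE 0).X₃ D) ⟶
        (DerivedCategory.Q.obj D)⟦(1 : ℤ)⟧),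
      Triangle.mk f g h ∈ distTriang (DerivedCategory (Sh k X)) := by
  have h₂ : (K.shortComplexTruncLE 0).X₂.IsStrictlyGE 0 := inferInstanceAs (K.IsStrictlyGE 0)
  obtain ⟨h₁, h₃⟩ := isStrictlyGE_shortComplexTruncLE K 0 0
  obtain ⟨i⟩ := nonempty_truncLE_iso_single K 0
  obtain ⟨unitor⟩ := nonempty_tensorObj_single_constSheaf_iso D
  let i' : tensorObj (K.truncLE 0) D ≅ D :=
    (tensorRightFunctor D).mapIso (i ≪≫ (single _ _ 0).mapIso e) ≪≫ unitor
  exact ⟨_, _, _, distinguished_of_iso₁₂ (DerivedCategory.triangleOfSES_distinguished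
    (shortExact_map_tensorRightFunctor (K.shortComplexTruncLE_shortExact 0) D 0))
    (DerivedCategory.Q.mapIso i'.symm) (Iso.refl _)⟩

lemma tensorFamily_Q_obj_tensorObj {L : DerivedCategory (Sh k X)}
    {K D : CochainComplex (Sh k X) ℤ} (e : L ≅ DerivedCategory.Q.obj K)
    (hD : ∀ q, IsLocallyConstantSheaf (D.homology q)) :
    tensorFamily L (DerivedCategory.Q.obj (tensorObj K D)) :=
  ⟨DerivedCategory.Q.obj D, fun q => (hD q).of_iso (homologyIsoOfIsoQ (Iso.refl _) q).symm,
    K, D, ⟨e.symm⟩, ⟨Iso.refl _⟩, ⟨Iso.refl _⟩⟩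

lemma isGE_shift_tensorPower {C : CochainComplex (Sh k X) ℤ} [C.IsStrictlyGE 0]
    (hC : ∀ p < 1, IsZero (C.homology p)) (j : ℕ) :
    ((DerivedCategory.Q.obj (tensorPower C j) : DerivedCategory (Sh k X))⟦-(j : ℤ)⟧).IsGE
      (2 * j : ℤ) := by
  have : (DerivedCategory.Q.obj (tensorPower C j) : DerivedCategory (Sh k X)).IsGE (j : ℤ) :=
    (DerivedCategory.isGE_iff _ _).2 fun p hp =>
      (isZero_homology_tensorPower hC j p hp).of_iso (homologyIsoOfIsoQ (Iso.refl _) p)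
  exact DerivedCategory.TStructure.t.isGE_shift _ (j : ℤ) _ _ (by ring)

lemma exists_distinguished_iteratedCones {L : DerivedCategory (Sh k X)} (hL : Dlc L)
    {K : CochainComplex (Sh k X) ℤ} [K.IsStrictlyGE 0] (eL : L ≅ DerivedCategory.Q.obj K)
    (e₀ : K.homology 0 ≅ constSheaf k X) (j : ℕ) :
    ∃ (Y F : DerivedCategory (Sh k X)) (u : Y ⟶ constObj k X) (v : constObj k X ⟶ F)
      (w : F ⟶ Y⟦(1 : ℤ)⟧), Y.IsGE (2 * (j + 1 : ℕ) : ℤ) ∧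
        Triangle.mk u v w ∈ distTriang (DerivedCategory (Sh k X)) ∧
          IteratedCones (tensorFamily L) j F := by
  let C := (K.shortComplexTruncLE 0).X₃
  have : C.IsStrictlyGE 0 := (isStrictlyGE_shortComplexTruncLE K 0 0).2
  have hC (p : ℤ) : IsLocallyConstantSheaf (C.homology p) :=
    isLocallyConstantSheaf_homology_shortComplexTruncLE_X₃
      (fun q => (hL q).of_iso (homologyIsoOfIsoQ eL q)) 0 p
  choose f g h hT using fun i => exists_distinguished_tensorObj K e₀ (tensorPower C i)
  obtain ⟨F, u, v, w, hF, hmem⟩ := exists_iteratedCones_of_distinguished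
    (P := fun i => (DerivedCategory.Q.obj (tensorPower C i) : DerivedCategory (Sh k X)))
    (fun i => tensorFamily_Q_obj_tensorObj eL (isLocallyConstantSheaf_homology_tensorPower hC i))
    hT j
  exact ⟨_, F, u, v, w,
    isGE_shift_tensorPower (fun _ hp => isZero_homology_shortComplexTruncLE_X₃ K hp) (j + 1),
    hF, hmem⟩

end Derived

lemma le_two_mul_ceil_add_one (n : ℕ) : n ≤ 2 * ⌈((n : ℚ) - 1) / 2⌉₊ + 1 := by
  have h : (n : ℚ) ≤ 2 * (⌈((n : ℚ) - 1) / 2⌉₊ : ℚ) + 1 := by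
    linarith [Nat.le_ceil (((n : ℚ) - 1) / 2)]
  exact_mod_cast h

end ConeIteration

end

theorem lemma5p2_general {k : Type u} [Field k] {X : TopCat.{u}} (n : ℕ)
    [ChartedSpace (EuclideanSpace ℝ (Fin n)) X] [HasDerivedCategory.{w} (ConeIteration.Sh k X)]
    (L : DerivedCategory (ConeIteration.Sh k X)) (hL : ConeIteration.Dlc L)
    (hneg : ∀ i : ℤ, i < 0 → IsZero ((DerivedCategory.homologyFunctor _ i).obj L))
    (hzero : Nonempty ((DerivedCategory.homologyFunctor _ 0).obj L ≅
      ConeIteration.constSheaf k X))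
    (j : ℕ) (hj : n ≤ 2 * j + 1) :
    ∃ F : DerivedCategory (ConeIteration.Sh k X),
      ConeIteration.IteratedCones (ConeIteration.tensorFamily L) j F ∧
        ConeIteration.IsDirectSummand (ConeIteration.constObj k X) F := by
  have hLge : L.IsGE 0 := (DerivedCategory.isGE_iff L 0).2 hneg
  obtain ⟨K, hK, ⟨eL⟩⟩ := DerivedCategory.exists_iso_Q_obj_of_isGE L 0
  obtain ⟨e₀⟩ := hzero
  obtain ⟨Y, F, u, v, w, hY, hF, hmem⟩ := ConeIteration.exists_distinguished_iteratedCones hL eL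
    ((ConeIteration.homologyIsoOfIsoQ eL 0).symm ≪≫ e₀) j
  have : Y.IsGE ((n : ℤ) + 1) :=
    DerivedCategory.TStructure.t.isGE_of_ge Y _ (2 * (j + 1 : ℕ) : ℤ) (by lia)
  have hu : u = 0 := ConeIteration.hom_constObj_eq_zero n u
  exact ⟨F, hmem, ConeIteration.isDirectSummand_of_distinguished_zero hF hu⟩

theorem lemma5p2 {k : Type u} [Field k] {M : Type u} [TopologicalSpace M] [T2Space M]
    [SecondCountableTopology M] (n : ℕ) [ChartedSpace (EuclideanSpace ℝ (Fin n)) M]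
    [HasDerivedCategory.{w} (ConeIteration.Sh k (TopCat.of M))]
    (L : DerivedCategory (ConeIteration.Sh k (TopCat.of M)))
    (hL : ConeIteration.Dlc L)
    (hneg : ∀ i : ℤ, i < 0 → IsZero ((DerivedCategory.homologyFunctor _ i).obj L))
    (hzero : Nonempty ((DerivedCategory.homologyFunctor _ 0).obj L ≅
      ConeIteration.constSheaf k (TopCat.of M))) :
    ∃ F : DerivedCategory (ConeIteration.Sh k (TopCat.of M)),
      ConeIteration.IteratedCones (ConeIteration.tensorFamily L) ⌈((n : ℚ) - 1) / 2⌉₊ F ∧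
        ConeIteration.IsDirectSummand (ConeIteration.constObj k (TopCat.of M)) F :=
  lemma5p2_general n L hL hneg hzero _ (ConeIteration.le_two_mul_ceil_add_one n)
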